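/- **Notation.** Let $\mathbb{R}_{\min}=\mathbb{R}\cup\{+\infty\}$ be the min-plus semiring, with $x\oplus y=\min(x,y)$ and $x\otimes y=x+y$, whose zero is $+\infty$ and unit is $0$. For $A\in\mathbb{R}_{\min}^{n\times n}$, $G(A)$ is the digraph on $\{1,\dots,n\}$ with an arc $(i,j)$ whenever $A_{ij}\ne+\infty$; $A$ is irreducible if any two nodes of $G(A)$ are joined by a path with at least one arc (i.e. $G(A)$ is strongly connected, the $1\times1$ matrix $(+\infty)$ being excluded). Let $\rho_{\min}(A)=\min_{1\le k\le n}\min_{i_1,\dots,i_k}\frac{1}{k}(A_{i_1i_2}+\cdots+A_{i_ki_1})$. A circuit of $G(A)$ is critical if its mean weight per arc is $\rho_{\min}(A)$; the critical graph $G^c(A)$ consists of the nodes and arcs of critical circuits. A vector $V\in\mathbb{R}_{\min}^n$, not identically $+\infty$, is an eigenvector of $A$ if $A\otimes V=\lambda\otimes V$ for some $\lambda\in\mathbb{R}_{\min}$, and $\mathrm{Sat}(A,V)$ is the digraph on $\{1,\dots,n\}$ with an arc $(i,j)$ whenever $(A\otimes V)_i=A_{ij}+V_j$. Put $(A^*)_{ij}=\inf_{m\ge0}(A^{\otimes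 m})_{ij}$. For a matrix $A$ indexed by $L\times L$, $C\subset L$, $N=L\setminus C$ and $\lambda\in\mathbb{R}$ with $\lambda\le\rho_{\min}(A_{CC})$, let $\mathrm{Schur}(C,\lambda,A)=A_{NN}\oplus A_{NC}\otimes(\lambda^{-1}A_{CC})^*\otimes\lambda^{-1}A_{CN}$ (min-plus operations; $\lambda^{-1}$ means subtracting $\lambda$). For a complex matrix $b$ with $b_{CC}$ invertible, $\mathrm{Schur}(C,b)=b_{NN}-b_{NC}(b_{CC})^{-1}b_{CN}$. For a digraph $G$ on $\{1,\dots,n\}$ and $b\in\mathbb{C}^{n\times n}$, $b^G$ has entries $b_{ij}$ on the arcs $(i,j)$ of $G$ and $0$ elsewhere. Let $\mathcal{C}$ be the ring of germs at $0^+$ of continuous functions $f:(0,\epsilon_0)\to\mathbb{C}$ with $|f(\epsilon)|\le\epsilon^{-k}$ for some $k>0$. Write $f(\epsilon)\simeq b\,\epsilon^B$ if $B\in\mathbb{R}$ and $\lim_{\epsilon\to0^+}\epsilon^{-B}f(\epsilon)=b$, or $B=+\infty$ and $f=0$ near $0^+$; write $f(\epsilon)\sim b\,\epsilon^B$ if moreover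 $b\ne0$ or $B=+\infty$. In these relations the right-hand sides are formal expressions. **Data.** Let $\mathcal{A}\in\mathcal{C}^{n\times n}$ satisfy $(\mathcal{A}_\epsilon)_{ij}\simeq a_{ij}\epsilon^{A_{ij}}$ for all $i,j$, where $a\in\mathbb{C}^{n\times n}$ and $A\in\mathbb{R}_{\min}^{n\times n}$ is irreducible. Put $A_1=A$ and, for $\ell\ge1$, let $\alpha_\ell=\rho_{\min}(A_\ell)$, let $C_\ell$ be the set of critical nodes of $A_\ell$ and, as long as $C_1\cup\dots\cup C_\ell\ne\{1,\dots,n\}$, let $A_{\ell+1}=\mathrm{Schur}(C_\ell,\alpha_\ell,A_\ell)$. This stops at some $\ell=k$, and $C_1,\dots,C_k$ partition $\{1,\dots,n\}$. Put $C^{\ell}=C_1\cup\dots\cup C_\ell$ ($C^0=\emptyset$) and $N^\ell=\{1,\dots,n\}\setminus C^{\ell-1}$; let $E_{N^\ell}$ be the complex diagonal matrix with diagonal entries $1$ on $N^\ell$ and $0$ elsewhere. For $1\le\ell\le k$ let $(\hat A_\ell)_{ij}=A_{ij}-d_i$, where $d_i=\alpha_m$ if $i\in C_m$ with $m<\ell$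 and $d_i=\alpha_\ell$ if $i\in N^\ell$; put $\hat A=\hat A_k$. Let $G$ be either $G^c(\hat A)$ or $\mathrm{Sat}(\hat A,U)$ for some eigenvector $U$ of $\hat A$, and set $r^\ell=(a^G)_{C^{\ell-1}C^{\ell-1}}$ (the empty matrix, which is invertible, if $\ell=1$), $s^\ell=\mathrm{Schur}(C^{\ell-1},a^G)$ (defined when $r^\ell$ is invertible; $s^1=a^G$) and $t^\ell=(s^\ell)_{C_\ell C_\ell}$. **Theorem.** Let $1\le\ell\le k$. Assume that $r^\ell$ is invertible, that $\mu\ne0$ is a simple eigenvalue of $t^\ell$ (a simple root of its characteristic polynomial), and let $V$ be any eigenvector of $\hat A_\ell$. Then: 1. The equation $(\mu E_{N^\ell}-a^{\mathrm{Sat}(\hat A_\ell,V)})w=0$ has a solution $w\in\mathbb{C}^n\setminus\{0\}$, unique up to a multiplicative constant. 2. There is a unique eigenvalue $\mathcal{L}_\epsilon$ of $\mathcal{A}_\epsilon$ with $\mathcal{L}_\epsilon\sim\mu\,\epsilon^{\alpha_\ell}$, eigenvalues being counted with multiplicity: there is $\mathcal{L}\in\mathcal{C}$ such that, for all small $\epsilon>0$,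 $\mathcal{L}_\epsilon$ is an eigenvalue of $\mathcal{A}_\epsilon$ of algebraic multiplicity one, and $\mathcal{L}_\epsilon\sim\mu\,\epsilon^{\alpha_\ell}$; and any function $\mathcal{L}'_\epsilon$ which is an eigenvalue of $\mathcal{A}_\epsilon$ for all small $\epsilon>0$ and satisfies $\mathcal{L}'_\epsilon\sim\mu\,\epsilon^{\alpha_\ell}$ coincides with $\mathcal{L}_\epsilon$ for all small $\epsilon>0$. 3. Let $w$ be a solution of the equation in 1, let $i$ be such that $w_i\ne0$, and let $\mathcal{V}_\epsilon$ be, for each small $\epsilon>0$, any eigenvector of $\mathcal{A}_\epsilon$ for the eigenvalue $\mathcal{L}_\epsilon$. Then $(\mathcal{V}_\epsilon)_i\ne0$ for all small $\epsilon>0$, and for all $j\in\{1,\dots,n\}$ $$\frac{(\mathcal{V}_\epsilon)_j}{(\mathcal{V}_\epsilon)_i}\simeq\frac{w_j\,\epsilon^{V_j}}{w_i\,\epsilon^{V_i}},\qquad\text{that is,}\qquad \lim_{\epsilon\to0^+}\epsilon^{V_i-V_j}\frac{(\mathcal{V}_\epsilon)_j}{(\mathcal{V}_\epsilon)_i}=\frac{w_j}{w_i}.$$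 -/

import Mathlib

open Filter Topology Matrix
open Tropical (trop untrop)

namespace MinPlus

/-- The min-plus semiring `ℝ ∪ {+∞}`: addition is `min`, multiplication is `+`,
the zero element is `+∞` and the unit element is the real number `0`. -/
abbrev Rmin : Type := Tropical (WithTop ℝ)

/-- A real number, seen as a (finite) element of the min-plus semiring. -/
def ofReal (x : ℝ) : Rmin := trop (x : WithTop ℝ)

section Graphs

variable {n : ℕ}

/-- The digraph of a min-plus matrix: an arc `(i, j)` whenever `A i j ≠ +∞`. -/
def graph (A : Matrix (Fin n) (Fin n) Rmin) : Digraph (Fin n) :=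
  ⟨fun i j => A i j ≠ 0⟩

/-- Irreducibility: any two nodes are joined by a path with at least one arc. This is strong
connectedness of the digraph; it differs from it only for the `1 × 1` matrix `(+∞)`, which has
no circuit and is excluded. -/
def IsIrred (A : Matrix (Fin n) (Fin n) Rmin) : Prop :=
  ∀ i j, Relation.TransGen (graph A).Adj i j

/-- The weight `A_{i₁i₂} + ⋯ + A_{iₖi₁}` of the closed sequence `(i₁, …, iₖ, i₁)`, of length
`k = p + 1` (addition in `Fin (p + 1)` is cyclic). It is `+∞` iff the sequence is not a circuit
of the digraph of `A`. -/
def circuitWeight (A : Matrix (Fin n) (Fin n) Rmin) {p : ℕ} (c : Fin (p + 1) → Fin n) : Rmin :=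
  ∏ m, A (c m) (c (m + 1))

/-- The mean weight per arc of a closed sequence of length `p + 1`. -/
noncomputable def circuitMean (A : Matrix (Fin n) (Fin n) Rmin) {p : ℕ}
    (c : Fin (p + 1) → Fin n) : Rmin :=
  trop ((untrop (circuitWeight A c)).map fun x => x / ((p : ℝ) + 1))

/-- `ρ_min(A)`: the minimum, over lengths `1, …, n` and closed sequences of that length, of
the mean weight (a sum in the min-plus semiring is a minimum). -/
noncomputable def rhoMin (A : Matrix (Fin n) (Fin n) Rmin) : Rmin :=
  ∑ p : Fin n, ∑ c : Fin ((p : ℕ) + 1) → Fin n, circuitMean A c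

/-- A critical circuit: a circuit of the digraph of `A` of mean weight `ρ_min(A)`. -/
def IsCriticalCircuit (A : Matrix (Fin n) (Fin n) Rmin) {p : ℕ} (c : Fin (p + 1) → Fin n) :
    Prop :=
  circuitWeight A c ≠ 0 ∧ circuitMean A c = rhoMin A

open Classical in
/-- The set of critical nodes: the nodes of critical circuits. -/
noncomputable def criticalNodes (A : Matrix (Fin n) (Fin n) Rmin) : Finset (Fin n) :=
  Finset.univ.filter fun i =>
    ∃ (p : ℕ) (c : Fin (p + 1) → Fin n), IsCriticalCircuit A c ∧ ∃ m, c m = i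

/-- The critical graph: its arcs are the arcs of critical circuits. -/
def criticalGraph (A : Matrix (Fin n) (Fin n) Rmin) : Digraph (Fin n) :=
  ⟨fun i j => ∃ (p : ℕ) (c : Fin (p + 1) → Fin n), IsCriticalCircuit A c ∧
    ∃ m, c m = i ∧ c (m + 1) = j⟩

/-- The saturation graph `Sat(A, V)`: an arc `(i, j)` whenever `(A V)_i = A_ij V_j`. -/
def satGraph (A : Matrix (Fin n) (Fin n) Rmin) (V : Fin n → Rmin) : Digraph (Fin n) :=
  ⟨fun i j => (A *ᵥ V) i = A i j * V j⟩

/-- `V` is a min-plus eigenvector of `A`. -/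
def IsEigenvector (A : Matrix (Fin n) (Fin n) Rmin) (V : Fin n → Rmin) : Prop :=
  V ≠ 0 ∧ ∃ lam : Rmin, A *ᵥ V = lam • V

/-- Kleene star: `(A^*)_{ij} = inf_{m ≥ 0} (A^m)_{ij}`. The infimum is the true one as soon as
these entries are bounded below, i.e. when `A` has no circuit of negative weight; the star is only
used for such matrices. -/
noncomputable def kleeneStar (A : Matrix (Fin n) (Fin n) Rmin) : Matrix (Fin n) (Fin n) Rmin :=
  Matrix.of fun i j => trop (⨅ m : ℕ, untrop ((A ^ m) i j))

/-- The block `A_{JK}`, kept as an `n × n` matrix by putting `+∞` outside `J × K`. -/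
def block (J K : Finset (Fin n)) (A : Matrix (Fin n) (Fin n) Rmin) :
    Matrix (Fin n) (Fin n) Rmin :=
  Matrix.of fun i j => if i ∈ J ∧ j ∈ K then A i j else 0

/-- The min-plus Schur complement
`Schur(C, λ, A) = A_{NN} ⊕ A_{NC} (λ⁻¹ A_{CC})^* λ⁻¹ A_{CN}`, where `N` is the complement of `C`.
It is kept as an `n × n` matrix, equal to `+∞` outside `N × N`; so an `L × L` matrix with
`L ⊆ {1, …, n}` is represented throughout by its extension by `+∞`. -/
noncomputable def schur (C : Finset (Fin n)) (lam : ℝ) (A : Matrix (Fin n) (Fin n) Rmin) :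
    Matrix (Fin n) (Fin n) Rmin :=
  block Cᶜ Cᶜ A +
    block Cᶜ C A * kleeneStar (ofReal (-lam) • block C C A) * (ofReal (-lam) • block C Cᶜ A)

/-! ### Critical values

Levels are numbered from `0`: level `ℓ` here is the level `ℓ + 1` of the usual numbering
`1, …, k`. -/

/-- The real number `ρ_min(A)` (used when `A` has a circuit). -/
noncomputable def rhoReal (A : Matrix (Fin n) (Fin n) Rmin) : ℝ := (untrop (rhoMin A)).untopD 0

/-- The matrices `A_ℓ`: the first one is `A`, and `A_{ℓ+1} = Schur(C_ℓ, α_ℓ, A_ℓ)` where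
`α_ℓ = ρ_min(A_ℓ)` and `C_ℓ` is the set of critical nodes of `A_ℓ`. -/
noncomputable def levelMatrix (A : Matrix (Fin n) (Fin n) Rmin) : ℕ → Matrix (Fin n) (Fin n) Rmin
  | 0 => A
  | ℓ + 1 => schur (criticalNodes (levelMatrix A ℓ)) (rhoReal (levelMatrix A ℓ)) (levelMatrix A ℓ)

/-- The critical value `α_ℓ = ρ_min(A_ℓ)`. -/
noncomputable def critVal (A : Matrix (Fin n) (Fin n) Rmin) (ℓ : ℕ) : ℝ :=
  rhoReal (levelMatrix A ℓ)

/-- The set `C_ℓ` of critical nodes of `A_ℓ`. -/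
noncomputable def levelNodes (A : Matrix (Fin n) (Fin n) Rmin) (ℓ : ℕ) : Finset (Fin n) :=
  criticalNodes (levelMatrix A ℓ)

/-- The union of the sets `C_m` over all levels `m` strictly before `ℓ`
(usually written `C^{ℓ-1}`). -/
noncomputable def nodesBefore (A : Matrix (Fin n) (Fin n) Rmin) (ℓ : ℕ) : Finset (Fin n) :=
  (Finset.range ℓ).biUnion (levelNodes A)

/-- `N^ℓ`, the complement of the union of the `C_m`, `m < ℓ`. -/
noncomputable def nodesFrom (A : Matrix (Fin n) (Fin n) Rmin) (ℓ : ℕ) : Finset (Fin n) :=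
  (nodesBefore A ℓ)ᶜ

/-- The number `k` of critical values: the first index at which all nodes have been exhausted. -/
noncomputable def numLevels (A : Matrix (Fin n) (Fin n) Rmin) : ℕ :=
  sInf {k : ℕ | nodesBefore A k = Finset.univ}

/-- The (first, and in fact only) level `m` such that `j ∈ C_m`. -/
noncomputable def levelOf (A : Matrix (Fin n) (Fin n) Rmin) (j : Fin n) : ℕ :=
  sInf {m : ℕ | j ∈ levelNodes A m}

/-- The diagonal of `D_ℓ`: `α_m` at `j ∈ C_m` with `m < ℓ`, and `α_ℓ` at `j ∈ N^ℓ`. -/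
noncomputable def levelDiag (A : Matrix (Fin n) (Fin n) Rmin) (ℓ : ℕ) (j : Fin n) : ℝ :=
  if j ∈ nodesFrom A ℓ then critVal A ℓ else critVal A (levelOf A j)

/-- `Â_ℓ = D_ℓ⁻¹ A`. -/
noncomputable def hat (A : Matrix (Fin n) (Fin n) Rmin) (ℓ : ℕ) : Matrix (Fin n) (Fin n) Rmin :=
  Matrix.diagonal (fun j => ofReal (-levelDiag A ℓ j)) * A

/-- `Â`, the matrix `Â_ℓ` of the last level. -/
noncomputable def hatLast (A : Matrix (Fin n) (Fin n) Rmin) : Matrix (Fin n) (Fin n) Rmin :=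
  hat A (numLevels A - 1)

/-! ### The conventional matrices -/

open Classical in
/-- `b^G`: the entries of `b` on the arcs of `G`, and `0` elsewhere. -/
noncomputable def restrictTo (G : Digraph (Fin n)) (b : Matrix (Fin n) (Fin n) ℂ) :
    Matrix (Fin n) (Fin n) ℂ :=
  Matrix.of fun i j => if G.Adj i j then b i j else 0

/-- The submatrix `b_{JK}` of a complex matrix. -/
def subMat (J K : Finset (Fin n)) (b : Matrix (Fin n) (Fin n) ℂ) : Matrix J K ℂ :=
  b.submatrix Subtype.val Subtype.val

/-- The conventional Schur complement `b_{NN} - b_{NC} (b_{CC})⁻¹ b_{CN}`, where `N` is the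
complement of `C` (meaningful when `b_{CC}` is invertible). -/
noncomputable def schurC (C : Finset (Fin n)) (b : Matrix (Fin n) (Fin n) ℂ) :
    Matrix ↥Cᶜ ↥Cᶜ ℂ :=
  subMat Cᶜ Cᶜ b - subMat Cᶜ C b * (subMat C C b)⁻¹ * subMat C Cᶜ b

/-- `r^ℓ`: the square submatrix of `a^G` indexed by the nodes of the levels before `ℓ`. -/
noncomputable def rMat (a : Matrix (Fin n) (Fin n) ℂ) (A : Matrix (Fin n) (Fin n) Rmin)
    (G : Digraph (Fin n)) (ℓ : ℕ) : Matrix (nodesBefore A ℓ) (nodesBefore A ℓ) ℂ :=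
  subMat (nodesBefore A ℓ) (nodesBefore A ℓ) (restrictTo G a)

/-- `s^ℓ`: the Schur complement in `a^G` of the nodes of the levels before `ℓ`; its index set
is `N^ℓ`. -/
noncomputable def sMat (a : Matrix (Fin n) (Fin n) ℂ) (A : Matrix (Fin n) (Fin n) Rmin)
    (G : Digraph (Fin n)) (ℓ : ℕ) : Matrix (nodesFrom A ℓ) (nodesFrom A ℓ) ℂ :=
  schurC (nodesBefore A ℓ) (restrictTo G a)

/-- `t^ℓ`: the `C_ℓ × C_ℓ` submatrix of `s^ℓ`. -/
noncomputable def tMat (a : Matrix (Fin n) (Fin n) ℂ) (A : Matrix (Fin n) (Fin n) Rmin)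
    (G : Digraph (Fin n)) (ℓ : ℕ) :
    Matrix {i : nodesFrom A ℓ // i.1 ∈ levelNodes A ℓ}
      {i : nodesFrom A ℓ // i.1 ∈ levelNodes A ℓ} ℂ :=
  (sMat a A G ℓ).submatrix Subtype.val Subtype.val

/-- `E_N`: the diagonal matrix with diagonal entries `1` on `N` and `0` elsewhere. -/
def diagIndicator (N : Finset (Fin n)) : Matrix (Fin n) (Fin n) ℂ :=
  Matrix.diagonal fun i => if i ∈ N then 1 else 0

end Graphs

/-! ### Asymptotics as `ε → 0⁺` -/

/-- `f` represents an element of the ring of germs at `0⁺` of continuous functions which are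
bounded by a negative power of `ε`. -/
def IsGerm (f : ℝ → ℂ) : Prop :=
  ∃ ε₀ > (0 : ℝ), ContinuousOn f (Set.Ioo 0 ε₀) ∧
    ∃ k > (0 : ℝ), ∀ ε ∈ Set.Ioo 0 ε₀, ‖f ε‖ ≤ ε ^ (-k)

/-- `f(ε) ≃ b ε^B`: if `B` is real, `ε^{-B} f(ε) → b` as `ε → 0⁺`; if `B = +∞`, `f` vanishes
near `0⁺`. -/
def Approx (f : ℝ → ℂ) (b : ℂ) (B : Rmin) : Prop :=
  (∀ x : ℝ, B = ofReal x →
    Tendsto (fun ε : ℝ => ((ε ^ (-x) : ℝ) : ℂ) * f ε) (𝓝[>] 0) (𝓝 b)) ∧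
  (B = 0 → ∀ᶠ ε in 𝓝[>] (0 : ℝ), f ε = 0)

/-- `f(ε) ∼ b ε^B`: as `f(ε) ≃ b ε^B`, with moreover `b ≠ 0` or `B = +∞`. -/
def Sim (f : ℝ → ℂ) (b : ℂ) (B : Rmin) : Prop :=
  (b ≠ 0 ∨ B = 0) ∧ Approx f b B

/-- `L ε` is an eigenvalue of `𝒜 ε` for all small `ε > 0`. -/
def IsEigenvalueFamily {n : ℕ} (𝒜 : ℝ → Matrix (Fin n) (Fin n) ℂ) (L : ℝ → ℂ) : Prop :=
  ∀ᶠ ε in 𝓝[>] (0 : ℝ), (𝒜 ε).charpoly.IsRoot (L ε)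

/-- `W ε` is an eigenvector of `𝒜 ε` for the eigenvalue `L ε`, for all small `ε > 0`. -/
def IsEigenvectorFamily {n : ℕ} (𝒜 : ℝ → Matrix (Fin n) (Fin n) ℂ) (L : ℝ → ℂ)
    (W : ℝ → Fin n → ℂ) : Prop :=
  ∀ᶠ ε in 𝓝[>] (0 : ℝ), W ε ≠ 0 ∧ 𝒜 ε *ᵥ W ε = L ε • W ε

end MinPlus

open MinPlus

namespace MinPlus

/-! ### Arithmetic of the min-plus semiring -/

/-! Irreducibility makes the eigenvector `V` finite, with real entries `v i`. With the row offsets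
`d = levelDiag A ℓ` one has `v i + d i ≤ A i j + v j`, with equality exactly on the arcs of
`Sat(Â_ℓ, V)`. Multiply row `i` of `𝒜 ε` by `ε ^ (-d i - v i)` and column `j` by `ε ^ v j`: the
result converges to `a^{Sat(Â_ℓ, V)}`. The same scaling turns `ε ^ α_ℓ` times the identity into the
diagonal matrix of the `ε ^ (α_ℓ - d i)`, which tends to `E_{N^ℓ}` because the critical values
strictly increase (`critVal_lt`). Thus `z ε ^ α_ℓ` is an eigenvalue of `𝒜 ε` iff `z` is a root of
the determinant of a pencil which converges as `ε → 0⁺`.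

If `μ` is a simple root for the limit pencil, the implicit function theorem gives exactly one nearby
root for small `ε` (`exists_root_pencil`). The derivative of the determinant is a combination of
diagonal entries of the adjugate, so the limit adjugate is nonzero: the limit kernel is a line, and
kernel vectors converge projectively to it (`tendsto_kernel`).

The combinatorial half shows that `μ` is such a root: the limit determinant is `c z^q` times the
characteristic polynomial of `t^ℓ`, with `c ≠ 0` (`det_satGraph`). A determinant `det (diag(e) -
b^G)` sees only the circuits of `G`. The difference of two potentials is monotone along the tight
arcs of one of them, hence constant on circuits, so tight circuits do not depend on the potential.
This identifies the circuits of `Sat(Â_ℓ, V)` with those of `G` restricted to the first levels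
(`circuits_satGraph`). That they stay in these levels is read off one potential, obtained from a
potential of `A_ℓ` by undoing the min-plus Schur complements (`exists_potential_levelDiag`). A
conventional Schur complement then produces `r^ℓ` and `t^ℓ`. -/

theorem ofReal_ne_zero (x : ℝ) : ofReal x ≠ 0 := Tropical.trop_coe_ne_zero x

theorem ofReal_injective : Function.Injective ofReal := fun _ _ h =>
  WithTop.coe_injective (Tropical.trop_injective h)

@[simp] theorem ofReal_inj {x y : ℝ} : ofReal x = ofReal y ↔ x = y := ofReal_injective.eq_iff

@[simp] theorem ofReal_le_ofReal {x y : ℝ} : ofReal x ≤ ofReal y ↔ x ≤ y :=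
  WithTop.coe_le_coe

theorem ofReal_mul (x y : ℝ) : ofReal x * ofReal y = ofReal (x + y) := rfl

theorem ofReal_zero : ofReal 0 = 1 := rfl

theorem eq_zero_or_ofReal (x : Rmin) : x = 0 ∨ ∃ r, x = ofReal r := by
  induction x using Tropical.tropRec with
  | _ x =>
    induction x using WithTop.recTopCoe with
    | top => exact Or.inl rfl
    | coe r => exact Or.inr ⟨r, rfl⟩

theorem ne_zero_iff {x : Rmin} : x ≠ 0 ↔ ∃ r, x = ofReal r := by
  constructor
  · intro h
    exact (eq_zero_or_ofReal x).resolve_left h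
  · rintro ⟨r, rfl⟩
    exact ofReal_ne_zero r

theorem le_ofReal {x : Rmin} {r : ℝ} : x ≤ ofReal r ↔ ∃ s, x = ofReal s ∧ s ≤ r := by
  rcases eq_zero_or_ofReal x with rfl | ⟨s, rfl⟩
  · constructor
    · intro h
      exact absurd (le_antisymm (Tropical.le_zero (ofReal r)) h) (ofReal_ne_zero r)
    · rintro ⟨s, hs, -⟩
      exact absurd hs.symm (ofReal_ne_zero s)
  · simp

theorem ofReal_le {x : Rmin} {r : ℝ} : ofReal r ≤ x ↔ ∀ s, x = ofReal s → r ≤ s := by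
  rcases eq_zero_or_ofReal x with rfl | ⟨s, rfl⟩
  · exact ⟨fun _ s hs => absurd hs.symm (ofReal_ne_zero s), fun _ => Tropical.le_zero _⟩
  · simp

theorem mul_eq_ofReal {x y : Rmin} {r : ℝ} :
    x * y = ofReal r ↔ ∃ a b, x = ofReal a ∧ y = ofReal b ∧ a + b = r := by
  rcases eq_zero_or_ofReal x with rfl | ⟨a, rfl⟩
  · simp [(ofReal_ne_zero _).symm]
  · rcases eq_zero_or_ofReal y with rfl | ⟨b, rfl⟩
    · simp [(ofReal_ne_zero _).symm]
    · simp [ofReal_mul]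

theorem ofReal_mul_eq_ofReal {y : Rmin} {a r : ℝ} :
    ofReal a * y = ofReal r ↔ y = ofReal (r - a) := by
  rw [mul_eq_ofReal]
  constructor
  · rintro ⟨a', b, h, rfl, rfl⟩
    rw [ofReal_inj] at h
    subst h
    simp
  · rintro rfl
    exact ⟨a, _, rfl, rfl, by ring⟩

theorem add_eq_left_or_right (x y : Rmin) : x + y = x ∨ x + y = y := by
  rcases le_total x y with h | h
  · exact Or.inl (Tropical.add_eq_left h)
  · exact Or.inr (Tropical.add_eq_right h)

theorem add_le_left (x y : Rmin) : x + y ≤ x := by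
  rcases le_total x y with h | h
  · exact (Tropical.add_eq_left h).le
  · exact (Tropical.add_eq_right h).le.trans h

theorem add_le_right (x y : Rmin) : x + y ≤ y := add_comm x y ▸ add_le_left y x

theorem sum_le {ι : Type*} {s : Finset ι} (f : ι → Rmin) {i : ι} (hi : i ∈ s) :
    ∑ j ∈ s, f j ≤ f i := by
  classical
  rw [← Finset.add_sum_erase s f hi]
  exact add_le_left _ _

theorem exists_sum_eq {ι : Type*} {s : Finset ι} {f : ι → Rmin} (h : ∑ j ∈ s, f j ≠ 0) :
    ∃ i ∈ s, ∑ j ∈ s, f j = f i := by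
  classical
  induction s using Finset.induction_on with
  | empty => simp at h
  | insert a s ha ih =>
    rw [Finset.sum_insert ha] at h ⊢
    rcases add_eq_left_or_right (f a) (∑ j ∈ s, f j) with h' | h'
    · exact ⟨a, by simp, h'⟩
    · rw [h'] at h ⊢
      obtain ⟨i, hi, e⟩ := ih h
      exact ⟨i, by simp [hi], e⟩

theorem prod_ofReal {ι : Type*} (s : Finset ι) (f : ι → ℝ) :
    ∏ i ∈ s, ofReal (f i) = ofReal (∑ i ∈ s, f i) := by
  classical
  induction s using Finset.induction_on with
  | empty => rfl
  | insert a s ha ih => rw [Finset.prod_insert ha, Finset.sum_insert ha, ih, ofReal_mul]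

theorem le_prod_ofReal {ι : Type*} (s : Finset ι) (f : ι → Rmin) (g : ι → ℝ)
    (h : ∀ i ∈ s, ofReal (g i) ≤ f i) : ofReal (∑ i ∈ s, g i) ≤ ∏ i ∈ s, f i := by
  rw [← prod_ofReal]
  exact Finset.prod_le_prod' h

/-! ### Walks, powers and the Kleene star. -/

section Walks

variable {n : ℕ}

theorem mul_apply_le (M N : Matrix (Fin n) (Fin n) Rmin) (i j k : Fin n) :
    (M * N) i k ≤ M i j * N j k := by
  rw [Matrix.mul_apply]
  exact sum_le (fun j => M i j * N j k) (Finset.mem_univ j)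

theorem exists_mul_apply_eq {M N : Matrix (Fin n) (Fin n) Rmin} {i k : Fin n}
    (h : (M * N) i k ≠ 0) : ∃ j, (M * N) i k = M i j * N j k := by
  rw [Matrix.mul_apply] at h ⊢
  obtain ⟨j, -, hj⟩ := exists_sum_eq h
  exact ⟨j, hj⟩

/-- The weight of the walk `w 0, w 1, …, w m`. -/
def walkWeight (M : Matrix (Fin n) (Fin n) Rmin) (w : ℕ → Fin n) (m : ℕ) : Rmin :=
  ∏ k ∈ Finset.range m, M (w k) (w (k + 1))

theorem pow_apply_le_walkWeight (M : Matrix (Fin n) (Fin n) Rmin) (w : ℕ → Fin n) (m : ℕ) :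
    (M ^ m) (w 0) (w m) ≤ walkWeight M w m := by
  induction m with
  | zero => simp [walkWeight]
  | succ m ih =>
    rw [pow_succ, walkWeight, Finset.prod_range_succ]
    exact (mul_apply_le _ _ _ (w m) _).trans (mul_le_mul_left ih _)

theorem exists_walkWeight_eq (M : Matrix (Fin n) (Fin n) Rmin) (m : ℕ) (i j : Fin n)
    (h : (M ^ m) i j ≠ 0) : ∃ w : ℕ → Fin n, w 0 = i ∧ w m = j ∧ (M ^ m) i j = walkWeight M w m := by
  induction m generalizing i with
  | zero =>
    have hij : i = j := by
      by_contra hne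
      simp [Matrix.one_apply_ne hne] at h
    subst hij
    exact ⟨fun _ => i, rfl, rfl, by simp [walkWeight]⟩
  | succ m ih =>
    rw [pow_succ'] at h ⊢
    obtain ⟨k, hk⟩ := exists_mul_apply_eq h
    have hk' : (M ^ m) k j ≠ 0 := by
      intro h0
      rw [hk, h0, mul_zero] at h
      exact h rfl
    obtain ⟨w, h0, hm, hw⟩ := ih k hk'
    refine ⟨fun t => Nat.casesOn t i w, rfl, hm, ?_⟩
    rw [hk, hw, walkWeight, walkWeight, Finset.prod_range_succ']
    simp [h0, mul_comm]

theorem walkWeight_add (M : Matrix (Fin n) (Fin n) Rmin) (w : ℕ → Fin n) (a b : ℕ) :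
    walkWeight M w (a + b) = walkWeight M w a * walkWeight M (fun k => w (a + k)) b := by
  simp [walkWeight, Finset.prod_range_add, add_assoc]

theorem walkWeight_eq_circuitWeight (M : Matrix (Fin n) (Fin n) Rmin) (w : ℕ → Fin n) (p : ℕ)
    (h : w (p + 1) = w 0) :
    walkWeight M w (p + 1) = circuitWeight M (fun k : Fin (p + 1) => w k) := by
  rw [walkWeight, circuitWeight, Finset.prod_range, Fin.prod_univ_castSucc,
    Fin.prod_univ_castSucc]
  congr 1
  · refine Finset.prod_congr rfl fun k _ => ?_
    congr 2
    rw [Fin.coeSucc_eq_succ]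
    simp
  · simp [h]

/-- Removing circuits of nonnegative weight shortens a walk without increasing its weight. -/
theorem exists_short_walk {M : Matrix (Fin n) (Fin n) Rmin}
    (hM : ∀ (p : Fin n) (c : Fin ((p : ℕ) + 1) → Fin n), 1 ≤ circuitWeight M c)
    (m : ℕ) (w : ℕ → Fin n) :
    ∃ m' < n, ∃ w' : ℕ → Fin n, w' 0 = w 0 ∧ w' m' = w m ∧
      walkWeight M w' m' ≤ walkWeight M w m := by
  induction m using Nat.strong_induction_on generalizing w with
  | _ m ih =>
    by_cases hm : m < n
    · exact ⟨m, hm, w, rfl, rfl, le_rfl⟩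
    -- Pigeonhole on the first `n + 1` nodes: the closed segment found has length at most `n`, the
    -- range covered by `hM`.
    obtain ⟨x, y, hxy, hw⟩ : ∃ x y : Fin (n + 1), x < y ∧ w x = w y := by
      obtain ⟨x, y, hne, h⟩ := Fintype.exists_ne_map_eq_of_card_lt
        (fun k : Fin (n + 1) => w k) (by simp)
      rcases lt_or_gt_of_ne hne with h' | h'
      · exact ⟨x, y, h', h⟩
      · exact ⟨y, x, h', h.symm⟩
    obtain ⟨p, hp⟩ : ∃ p, (y : ℕ) = x + (p + 1) := ⟨y - x - 1, by omega⟩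
    obtain ⟨q, hq⟩ : ∃ q, m = x + (p + 1) + q := ⟨m - y, by omega⟩
    have hpn : p < n := by omega
    -- The walk with the closed segment between `x` and `y` cut out.
    set w₂ : ℕ → Fin n := fun k => if k ≤ x then w k else w (k + (p + 1)) with hw₂
    have hx : w₂ x = w x := by simp [hw₂]
    have e1 : walkWeight M w₂ x = walkWeight M w x := by
      refine Finset.prod_congr rfl fun k hk => ?_
      have := Finset.mem_range.1 hk
      simp [hw₂, this.le, Nat.succ_le_iff.2 this]
    have hshift : ∀ k, w₂ (x + k) = w (x + (p + 1) + k) := by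
      intro k
      rcases Nat.eq_zero_or_pos k with rfl | hk
      · simp only [add_zero, hx]
        rw [← hp, hw]
      · have : ¬ (x + k ≤ (x : ℕ)) := by omega
        simp only [hw₂, if_neg this]
        congr 1
        omega
    have e2 : walkWeight M (fun k => w₂ (x + k)) q =
        walkWeight M (fun k => w (x + (p + 1) + k)) q := by
      simp [hshift]
    have hcyc : 1 ≤ walkWeight M (fun k => w (x + k)) (p + 1) := by
      rw [walkWeight_eq_circuitWeight _ _ _ (by simpa [← hp] using hw.symm)]
      exact hM ⟨p, hpn⟩ _
    have hle : walkWeight M w₂ (x + q) ≤ walkWeight M w m := by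
      rw [hq, walkWeight_add, walkWeight_add, walkWeight_add, e1, e2]
      gcongr
      calc walkWeight M w x = walkWeight M w x * 1 := (mul_one _).symm
        _ ≤ _ := mul_le_mul_right hcyc _
    obtain ⟨m', hm', w', h0, h1, h2⟩ := ih (x + q) (by omega) w₂
    refine ⟨m', hm', w', h0.trans (by simp [hw₂]), h1.trans ?_, h2.trans hle⟩
    rw [hshift, hq]

theorem exists_short_pow_le {M : Matrix (Fin n) (Fin n) Rmin}
    (hM : ∀ (p : Fin n) (c : Fin ((p : ℕ) + 1) → Fin n), 1 ≤ circuitWeight M c)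
    (m : ℕ) (i j : Fin n) : ∃ m' < n, (M ^ m') i j ≤ (M ^ m) i j := by
  by_cases h : (M ^ m) i j = 0
  · exact ⟨0, i.pos, h ▸ Tropical.le_zero _⟩
  obtain ⟨w, rfl, rfl, hw⟩ := exists_walkWeight_eq M m i j h
  obtain ⟨m', hm', w', h0, h1, hle⟩ := exists_short_walk hM m w
  refine ⟨m', hm', ?_⟩
  rw [hw, ← h0, ← h1]
  exact (pow_apply_le_walkWeight M w' m').trans hle

/-- Walks of length less than `n` already achieve all the minimal weights, so the infimum is a
minimum over finitely many powers. -/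
theorem kleeneStar_attained {M : Matrix (Fin n) (Fin n) Rmin}
    (hM : ∀ (p : Fin n) (c : Fin ((p : ℕ) + 1) → Fin n), 1 ≤ circuitWeight M c) (i j : Fin n) :
    (∀ m, kleeneStar M i j ≤ (M ^ m) i j) ∧ ∃ m, kleeneStar M i j = (M ^ m) i j := by
  obtain ⟨m₀, -, hm₀⟩ := Finset.exists_min_image (Finset.range n) (fun m => (M ^ m) i j)
    ⟨0, Finset.mem_range.2 i.pos⟩
  have hmin : ∀ m, (M ^ m₀) i j ≤ (M ^ m) i j := by
    intro m
    obtain ⟨m', hm', hle⟩ := exists_short_pow_le hM m i j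
    exact (hm₀ m' (Finset.mem_range.2 hm')).trans hle
  have hleast : IsLeast (Set.range fun m => untrop ((M ^ m) i j)) (untrop ((M ^ m₀) i j)) :=
    ⟨⟨m₀, rfl⟩, by rintro _ ⟨m, rfl⟩; exact hmin m⟩
  have heq : kleeneStar M i j = (M ^ m₀) i j := by
    change trop (sInf (Set.range fun m => untrop ((M ^ m) i j))) = _
    rw [hleast.csInf_eq, Tropical.trop_untrop]
  exact ⟨fun m => heq ▸ hmin m, m₀, heq⟩

end Walks

/-! ### Potentials, critical circuits and tight arcs. -/

section Potentials

open Relation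

variable {n : ℕ}

/-- `u` is a potential for the matrix obtained from `M` by subtracting `d i` from its `i`-th row:
that matrix has the subeigenvector `u` for the eigenvalue `0`. -/
def IsPotential (M : Matrix (Fin n) (Fin n) Rmin) (d u : Fin n → ℝ) : Prop :=
  ∀ i j x, M i j = ofReal x → u i + d i ≤ x + u j

/-- The arcs at which the inequality defining a potential is an equality. -/
def Tight (M : Matrix (Fin n) (Fin n) Rmin) (d u : Fin n → ℝ) (i j : Fin n) : Prop :=
  M i j = ofReal (u i + d i - u j)

theorem IsPotential.le {M : Matrix (Fin n) (Fin n) Rmin} {d u : Fin n → ℝ}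
    (h : IsPotential M d u) (i j : Fin n) : ofReal (u i + d i - u j) ≤ M i j :=
  ofReal_le.2 fun s hs => by linarith [h i j s hs]

/-! ### Closed sequences and relations -/

open Fin.NatCast in
theorem reflTransGen_of_circuit {R : Fin n → Fin n → Prop} {p : ℕ} {c : Fin (p + 1) → Fin n}
    (hc : ∀ m, R (c m) (c (m + 1))) (x y : Fin (p + 1)) : ReflTransGen R (c x) (c y) := by
  have key : ∀ k : ℕ, ReflTransGen R (c x) (c (x + (k : Fin (p + 1)))) := by
    intro k
    induction k with
    | zero => simpa using ReflTransGen.refl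
    | succ k ih =>
      refine ih.tail ?_
      have := hc (x + (k : Fin (p + 1)))
      rwa [add_assoc, ← Nat.cast_succ] at this
  have := key (y - x : Fin (p + 1)).val
  rwa [Fin.cast_val_eq_self, add_sub_cancel] at this

theorem exists_walk_of_reflTransGen {R : Fin n → Fin n → Prop} {i j : Fin n}
    (h : ReflTransGen R i j) :
    ∃ (q : ℕ) (w : ℕ → Fin n), w 0 = i ∧ w q = j ∧ ∀ k < q, R (w k) (w (k + 1)) := by
  induction h using ReflTransGen.head_induction_on with
  | refl => exact ⟨0, fun _ => j, rfl, rfl, by simp⟩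
  | @head x _ h _ ih =>
    obtain ⟨q, w, h0, hq, hw⟩ := ih
    refine ⟨q + 1, fun t => Nat.casesOn t x w, rfl, hq, ?_⟩
    rintro (_ | k) hk
    · simpa [h0] using h
    · exact hw k (by omega)

theorem exists_circuit {R : Fin n → Fin n → Prop} {i j : Fin n} (hij : R i j)
    (hji : ReflTransGen R j i) :
    ∃ (p : ℕ) (c : Fin (p + 1) → Fin n), (∀ m, R (c m) (c (m + 1))) ∧
      ∃ m, c m = i ∧ c (m + 1) = j := by
  obtain ⟨q, w, h0, hq, hw⟩ := exists_walk_of_reflTransGen hji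
  refine ⟨q, fun k => w k, ?_, Fin.last q, by simpa, by simpa⟩
  intro m
  induction m using Fin.lastCases with
  | last => simpa [hq, h0]
  | cast m =>
    rw [Fin.coeSucc_eq_succ]
    simpa using hw m m.2

/-! ### Weights of circuits -/

theorem sum_circuit_gap (d u : Fin n → ℝ) {p : ℕ} (c : Fin (p + 1) → Fin n) :
    ∑ m, (u (c m) + d (c m) - u (c (m + 1))) = ∑ m, d (c m) := by
  have : ∑ m, u (c (m + 1)) = ∑ m, u (c m) :=
    Equiv.sum_comp (Equiv.addRight (1 : Fin (p + 1))) fun m => u (c m)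
  rw [Finset.sum_sub_distrib, Finset.sum_add_distrib, this]
  ring

theorem IsPotential.le_circuitWeight {M : Matrix (Fin n) (Fin n) Rmin} {d u : Fin n → ℝ}
    (h : IsPotential M d u) {p : ℕ} (c : Fin (p + 1) → Fin n) :
    ofReal (∑ m, d (c m)) ≤ circuitWeight M c := by
  rw [← sum_circuit_gap d u c]
  exact le_prod_ofReal _ _ _ fun m _ => h.le _ _

theorem circuitWeight_ne_zero_iff (M : Matrix (Fin n) (Fin n) Rmin) {p : ℕ}
    (c : Fin (p + 1) → Fin n) : circuitWeight M c ≠ 0 ↔ ∀ m, M (c m) (c (m + 1)) ≠ 0 := by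
  simp [circuitWeight, Finset.prod_eq_zero_iff]

/-- The potential telescopes around a circuit, and a sum of inequalities is an equality only if each
of them is. -/
theorem IsPotential.circuitWeight_eq_iff {M : Matrix (Fin n) (Fin n) Rmin} {d u : Fin n → ℝ}
    (h : IsPotential M d u) {p : ℕ} (c : Fin (p + 1) → Fin n) :
    circuitWeight M c = ofReal (∑ m, d (c m)) ↔ ∀ m, Tight M d u (c m) (c (m + 1)) := by
  rw [← sum_circuit_gap d u c]
  constructor
  · intro hw
    have hne : ∀ m, M (c m) (c (m + 1)) ≠ 0 :=
      (circuitWeight_ne_zero_iff M c).1 (hw ▸ ofReal_ne_zero _)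
    choose x hx using fun m => ne_zero_iff.1 (hne m)
    rw [circuitWeight, Finset.prod_congr rfl fun m _ => hx m, prod_ofReal, ofReal_inj] at hw
    have := (Finset.sum_eq_sum_iff_of_le fun m _ => by
      linarith [h _ _ _ (hx m)] : (∑ m, (u (c m) + d (c m) - u (c (m + 1))) = ∑ m, x m) ↔ _).1
      hw.symm
    intro m
    rw [Tight, hx, this m (Finset.mem_univ m)]
  · intro ht
    rw [circuitWeight, Finset.prod_congr rfl fun m _ => ht m, prod_ofReal]

theorem IsPotential.one_le_circuitWeight {M : Matrix (Fin n) (Fin n) Rmin} {u : Fin n → ℝ}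
    (h : IsPotential M 0 u) {p : ℕ} (c : Fin (p + 1) → Fin n) : 1 ≤ circuitWeight M c := by
  simpa [← ofReal_zero] using h.le_circuitWeight c

theorem circuitMean_eq_ofReal (M : Matrix (Fin n) (Fin n) Rmin) {p : ℕ}
    (c : Fin (p + 1) → Fin n) {x : ℝ} (h : circuitWeight M c = ofReal x) :
    circuitMean M c = ofReal (x / (p + 1)) := by
  rw [circuitMean, h]
  rfl

theorem circuitMean_eq_zero (M : Matrix (Fin n) (Fin n) Rmin) {p : ℕ}
    (c : Fin (p + 1) → Fin n) (h : circuitWeight M c = 0) : circuitMean M c = 0 := by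
  rw [circuitMean, h]
  rfl

theorem circuitMean_eq_ofReal_iff (M : Matrix (Fin n) (Fin n) Rmin) {p : ℕ}
    (c : Fin (p + 1) → Fin n) {x : ℝ} :
    circuitMean M c = ofReal x ↔ circuitWeight M c = ofReal ((p + 1) * x) := by
  rcases eq_zero_or_ofReal (circuitWeight M c) with h | ⟨y, h⟩
  · rw [circuitMean_eq_zero M c h, h]
    exact ⟨fun h => absurd h.symm (ofReal_ne_zero _), fun h => absurd h.symm (ofReal_ne_zero _)⟩
  · rw [circuitMean_eq_ofReal M c h, h, ofReal_inj, ofReal_inj, div_eq_iff (by positivity),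
      mul_comm]

theorem ofReal_le_circuitMean_iff (M : Matrix (Fin n) (Fin n) Rmin) {p : ℕ}
    (c : Fin (p + 1) → Fin n) {x : ℝ} :
    ofReal x ≤ circuitMean M c ↔ ofReal ((p + 1) * x) ≤ circuitWeight M c := by
  rcases eq_zero_or_ofReal (circuitWeight M c) with h | ⟨y, h⟩
  · rw [circuitMean_eq_zero M c h, h]
    exact ⟨fun _ => Tropical.le_zero _, fun _ => Tropical.le_zero _⟩
  · rw [circuitMean_eq_ofReal M c h, h, ofReal_le_ofReal, ofReal_le_ofReal,
      le_div_iff₀ (by positivity), mul_comm]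

theorem rhoMin_le_circuitMean (M : Matrix (Fin n) (Fin n) Rmin) (p : Fin n)
    (c : Fin ((p : ℕ) + 1) → Fin n) : rhoMin M ≤ circuitMean M c :=
  (sum_le _ (Finset.mem_univ p)).trans (sum_le (fun c => circuitMean M c) (Finset.mem_univ c))

theorem exists_circuitMean_eq_rhoMin {M : Matrix (Fin n) (Fin n) Rmin} (h : rhoMin M ≠ 0) :
    ∃ (p : Fin n) (c : Fin ((p : ℕ) + 1) → Fin n), circuitMean M c = rhoMin M := by
  obtain ⟨p, -, hp⟩ := exists_sum_eq h
  change rhoMin M = _ at hp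
  rw [hp] at h
  obtain ⟨c, -, hc⟩ := exists_sum_eq h
  exact ⟨p, c, (hp.trans hc).symm⟩

theorem exists_isCriticalCircuit {M : Matrix (Fin n) (Fin n) Rmin} (h : rhoMin M ≠ 0) :
    ∃ (p : Fin n) (c : Fin ((p : ℕ) + 1) → Fin n), IsCriticalCircuit M c := by
  obtain ⟨p, c, hc⟩ := exists_circuitMean_eq_rhoMin h
  refine ⟨p, c, fun h0 => h ?_, hc⟩
  rw [← hc, circuitMean_eq_zero M c h0]

/-- A matrix with a stable nonempty set of nodes having successors has a circuit. -/
theorem rhoMin_ne_zero {M : Matrix (Fin n) (Fin n) Rmin} {P : Fin n → Prop} {i : Fin n} (hi : P i)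
    (hP : ∀ i, P i → ∃ j, P j ∧ M i j ≠ 0) : rhoMin M ≠ 0 := by
  intro h0
  choose! f hf using hP
  have hw : ∀ m, P (f^[m] i) := by
    intro m
    induction m with
    | zero => exact hi
    | succ m ih =>
      rw [Function.iterate_succ_apply']
      exact (hf _ ih).1
  -- The orbit under a choice of successors repeats itself within `n + 1` terms, which yields a
  -- circuit of length at most `n`.
  obtain ⟨x, y, hxy, he⟩ : ∃ x y : Fin (n + 1), x < y ∧ f^[x] i = f^[y] i := by
    obtain ⟨x, y, hne, h⟩ := Fintype.exists_ne_map_eq_of_card_lt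
      (fun k : Fin (n + 1) => f^[k] i) (by simp)
    rcases lt_or_gt_of_ne hne with h' | h'
    · exact ⟨x, y, h', h⟩
    · exact ⟨y, x, h', h.symm⟩
  obtain ⟨p, hp⟩ : ∃ p, (y : ℕ) = x + (p + 1) := ⟨y - x - 1, by omega⟩
  have hpn : p < n := by omega
  set w : ℕ → Fin n := fun k => f^[x + k] i with hwdef
  have hne : walkWeight M w (p + 1) ≠ 0 := by
    rw [walkWeight, Finset.prod_ne_zero_iff]
    intro k _
    have := (hf _ (hw (x + k))).2
    rwa [← Function.iterate_succ_apply' f] at this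
  rw [walkWeight_eq_circuitWeight M w p (by simp [hwdef, ← hp, he])] at hne
  obtain ⟨r, hr⟩ := ne_zero_iff.1 hne
  have hle := rhoMin_le_circuitMean M ⟨p, hpn⟩ fun k => w k
  rw [h0, circuitMean_eq_ofReal M _ hr] at hle
  exact ofReal_ne_zero _ (le_antisymm (Tropical.le_zero (ofReal _)) hle)

/-! ### Critical graphs and tight arcs -/

theorem IsPotential.isCriticalCircuit_iff {M : Matrix (Fin n) (Fin n) Rmin} {r : ℝ}
    {u : Fin n → ℝ} (h : IsPotential M (fun _ => r) u) (hM : rhoMin M = ofReal r) {p : ℕ}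
    (c : Fin (p + 1) → Fin n) :
    IsCriticalCircuit M c ↔ ∀ m, Tight M (fun _ => r) u (c m) (c (m + 1)) := by
  rw [← h.circuitWeight_eq_iff, IsCriticalCircuit, hM, circuitMean_eq_ofReal_iff]
  simp only [Finset.sum_const, Finset.card_univ, Fintype.card_fin, nsmul_eq_mul, Nat.cast_add,
    Nat.cast_one, and_iff_right_iff_imp]
  rintro h
  exact h ▸ ofReal_ne_zero _

theorem IsPotential.criticalGraph_adj_iff {M : Matrix (Fin n) (Fin n) Rmin} {r : ℝ}
    {u : Fin n → ℝ} (h : IsPotential M (fun _ => r) u) (hM : rhoMin M = ofReal r) (i j : Fin n) :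
    (criticalGraph M).Adj i j ↔
      Tight M (fun _ => r) u i j ∧ ReflTransGen (Tight M (fun _ => r) u) j i := by
  constructor
  · rintro ⟨p, c, hc, m, rfl, rfl⟩
    rw [h.isCriticalCircuit_iff hM] at hc
    exact ⟨hc m, reflTransGen_of_circuit hc _ _⟩
  · rintro ⟨hij, hji⟩
    obtain ⟨p, c, hc, hm⟩ := exists_circuit hij hji
    exact ⟨p, c, (h.isCriticalCircuit_iff hM c).2 hc, hm⟩

theorem IsPotential.mem_criticalNodes_iff {M : Matrix (Fin n) (Fin n) Rmin} {r : ℝ}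
    {u : Fin n → ℝ} (h : IsPotential M (fun _ => r) u) (hM : rhoMin M = ofReal r) (i : Fin n) :
    i ∈ criticalNodes M ↔ TransGen (Tight M (fun _ => r) u) i i := by
  simp only [criticalNodes, Finset.mem_filter, Finset.mem_univ, true_and]
  rw [TransGen.head'_iff]
  constructor
  · rintro ⟨p, c, hc, m, rfl⟩
    rw [h.isCriticalCircuit_iff hM] at hc
    exact ⟨_, hc m, reflTransGen_of_circuit hc _ _⟩
  · rintro ⟨j, hij, hji⟩
    obtain ⟨p, c, hc, m, hm, -⟩ := exists_circuit hij hji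
    exact ⟨p, c, (h.isCriticalCircuit_iff hM c).2 hc, m, hm⟩

theorem smul_apply_eq_ofReal {M : Matrix (Fin n) (Fin n) Rmin} {a x : ℝ} {i j : Fin n} :
    (ofReal a • M) i j = ofReal x ↔ M i j = ofReal (x - a) := by
  rw [Matrix.smul_apply, smul_eq_mul, ofReal_mul_eq_ofReal]

/-- A matrix of minimal circuit mean `r` has a potential. -/
theorem exists_isPotential {M : Matrix (Fin n) (Fin n) Rmin} {r : ℝ} (hM : rhoMin M = ofReal r) :
    ∃ u, IsPotential M (fun _ => r) u := by
  set Q := ofReal (-r) • M with hQ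
  have hcirc : ∀ (p : Fin n) (c : Fin ((p : ℕ) + 1) → Fin n), 1 ≤ circuitWeight Q c := by
    intro p c
    have h1 : ofReal ((p + 1) * r) ≤ circuitWeight M c :=
      (ofReal_le_circuitMean_iff M c).1 (hM ▸ rhoMin_le_circuitMean M p c)
    have h2 : circuitWeight Q c = ofReal (∑ _m : Fin ((p : ℕ) + 1), -r) * circuitWeight M c := by
      rw [← prod_ofReal, circuitWeight, circuitWeight, ← Finset.prod_mul_distrib]
      rfl
    rw [h2, ← ofReal_zero]
    calc ofReal 0 = ofReal (∑ _m : Fin ((p : ℕ) + 1), -r) * ofReal ((p + 1) * r) := by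
          rw [ofReal_mul]
          simp
      _ ≤ _ := mul_le_mul_right h1 _
  -- `f i` is the least reduced weight of a walk of length less than `n` starting at `i`, with free
  -- endpoint. The empty walk makes it finite, so irreducibility is not needed.
  set f : Fin n → Rmin := fun i => ∑ m ∈ Finset.range n, ∑ j, (Q ^ m) i j with hf
  have hf1 : ∀ i, f i ≤ ofReal 0 := by
    intro i
    have h0 : 0 ∈ Finset.range n := Finset.mem_range.2 i.pos
    refine (sum_le _ h0).trans ((sum_le _ (Finset.mem_univ i)).trans ?_)
    simp [ofReal_zero]
  choose u hu _ using fun i => le_ofReal.1 (hf1 i)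
  refine ⟨u, fun i j x hx => ?_⟩
  have hne : f j ≠ 0 := by
    rw [hu]
    exact ofReal_ne_zero _
  obtain ⟨m, -, hm⟩ := exists_sum_eq hne
  change f j = _ at hm
  obtain ⟨l, -, hl⟩ := exists_sum_eq (hm ▸ hne)
  obtain ⟨m', hm', hle⟩ := exists_short_pow_le hcirc (m + 1) i l
  have h1 : f i ≤ (Q ^ m') i l :=
    (sum_le _ (Finset.mem_range.2 hm')).trans (sum_le (fun l => (Q ^ m') i l) (Finset.mem_univ l))
  have h2 : (Q ^ (m + 1)) i l ≤ Q i j * (Q ^ m) j l := by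
    rw [pow_succ']
    exact mul_apply_le _ _ _ _ _
  have h3 := h1.trans (hle.trans h2)
  have hQij : Q i j = ofReal (x - r) := by
    rw [hQ, smul_apply_eq_ofReal, hx]
    simp
  rw [← hl, ← hm, hu, hu, hQij, ofReal_mul, ofReal_le_ofReal] at h3
  linarith

end Potentials

/-! ### Potentials and connectivity under min-plus Schur complements. -/

section Schur

open Relation

variable {n : ℕ}

/-- `(λ⁻¹ M_{CC})^* λ⁻¹ M_{CN}`: the minimal weights of the walks in `C` which end by an exit
from `C`. -/
noncomputable def exitMatrix (C : Finset (Fin n)) (r : ℝ) (M : Matrix (Fin n) (Fin n) Rmin) :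
    Matrix (Fin n) (Fin n) Rmin :=
  kleeneStar (ofReal (-r) • block C C M) * (ofReal (-r) • block C Cᶜ M)

theorem schur_eq (C : Finset (Fin n)) (r : ℝ) (M : Matrix (Fin n) (Fin n) Rmin) :
    schur C r M = block Cᶜ Cᶜ M + block Cᶜ C M * exitMatrix C r M := by
  rw [schur, exitMatrix, Matrix.mul_assoc]

theorem block_apply_of_mem {J K : Finset (Fin n)} {i j : Fin n} (hi : i ∈ J) (hj : j ∈ K)
    (M : Matrix (Fin n) (Fin n) Rmin) : block J K M i j = M i j := by
  simp [block, hi, hj]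

theorem block_eq_ofReal {J K : Finset (Fin n)} {i j : Fin n} {M : Matrix (Fin n) (Fin n) Rmin}
    {x : ℝ} : block J K M i j = ofReal x ↔ (i ∈ J ∧ j ∈ K) ∧ M i j = ofReal x := by
  by_cases h : i ∈ J ∧ j ∈ K
  · simp [block, h]
  · simp [block, h, (ofReal_ne_zero _).symm]

theorem smul_block_eq_ofReal {J K : Finset (Fin n)} {i j : Fin n}
    {M : Matrix (Fin n) (Fin n) Rmin} {r x : ℝ} :
    (ofReal (-r) • block J K M) i j = ofReal x ↔ (i ∈ J ∧ j ∈ K) ∧ M i j = ofReal (x + r) := by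
  rw [smul_apply_eq_ofReal, block_eq_ofReal, sub_neg_eq_add]

theorem schur_apply_le {C : Finset (Fin n)} {i j : Fin n} (hi : i ∉ C) (hj : j ∉ C) (r : ℝ)
    (M : Matrix (Fin n) (Fin n) Rmin) : schur C r M i j ≤ M i j := by
  rw [schur_eq, Matrix.add_apply]
  refine (add_le_left _ _).trans ?_
  rw [block_apply_of_mem (by simpa) (by simpa)]

theorem schur_apply_le_mul {C : Finset (Fin n)} {i k : Fin n} (hi : i ∉ C) (hk : k ∈ C) (r : ℝ)
    (M : Matrix (Fin n) (Fin n) Rmin) (j : Fin n) :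
    schur C r M i j ≤ M i k * exitMatrix C r M k j := by
  rw [schur_eq, Matrix.add_apply]
  refine (add_le_right _ _).trans ((mul_apply_le _ _ _ k _).trans ?_)
  rw [block_apply_of_mem (by simpa) hk]

theorem schur_apply_cases {C : Finset (Fin n)} {r : ℝ} {M : Matrix (Fin n) (Fin n) Rmin}
    {i j : Fin n} {x : ℝ} (h : schur C r M i j = ofReal x) :
    (i ∉ C ∧ j ∉ C) ∧ (M i j = ofReal x ∨
      ∃ k ∈ C, ∃ y z, M i k = ofReal y ∧ exitMatrix C r M k j = ofReal z ∧ y + z = x) := by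
  rw [schur_eq, Matrix.add_apply] at h
  rcases add_eq_left_or_right (block Cᶜ Cᶜ M i j) ((block Cᶜ C M * exitMatrix C r M) i j)
    with h' | h'
  · rw [h', block_eq_ofReal] at h
    simp only [Finset.mem_compl] at h
    exact ⟨h.1, Or.inl h.2⟩
  · rw [h'] at h
    obtain ⟨k, hk⟩ := exists_mul_apply_eq (h ▸ ofReal_ne_zero x)
    rw [h] at hk
    obtain ⟨y, z, hy, hz, hyz⟩ := mul_eq_ofReal.1 hk.symm
    rw [block_eq_ofReal, Finset.mem_compl] at hy
    obtain ⟨l, hl⟩ := exists_mul_apply_eq (hz ▸ ofReal_ne_zero z : exitMatrix C r M k j ≠ 0)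
    change exitMatrix C r M k j = _ at hl
    rw [hz] at hl
    obtain ⟨_, _, -, hb, -⟩ := mul_eq_ofReal.1 hl.symm
    rw [smul_block_eq_ofReal, Finset.mem_compl] at hb
    exact ⟨⟨hy.1.1, hb.1.2⟩, Or.inr ⟨k, hy.1.2, y, z, hy.2, hz, hyz⟩⟩

variable {C : Finset (Fin n)} {r : ℝ} {M : Matrix (Fin n) (Fin n) Rmin} {u : Fin n → ℝ}

theorem IsPotential.smul_block (h : IsPotential M (fun _ => r) u) :
    IsPotential (ofReal (-r) • block C C M) 0 u := by
  intro i j x hx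
  rw [smul_block_eq_ofReal] at hx
  have := h i j _ hx.2
  simp only [Pi.zero_apply]
  linarith

theorem IsPotential.exitMatrix_le (h : IsPotential M (fun _ => r) u) {k j : Fin n} (hk : k ∈ C)
    (hj : j ∉ C) : exitMatrix C r M k j ≤ ofReal (-r) * M k j := by
  refine (mul_apply_le _ _ _ k _).trans ?_
  have h1 := (kleeneStar_attained
    (fun p c => (h.smul_block (C := C)).one_le_circuitWeight c) k k).1 0
  rw [pow_zero, Matrix.one_apply_eq] at h1
  refine (mul_le_mul_left h1 _).trans ?_
  rw [one_mul, Matrix.smul_apply, block_apply_of_mem hk (by simpa), smul_eq_mul]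

theorem IsPotential.exitMatrix_le_mul (h : IsPotential M (fun _ => r) u) {k k' : Fin n}
    (hk : k ∈ C) (hk' : k' ∈ C) (j : Fin n) :
    exitMatrix C r M k j ≤ ofReal (-r) * M k k' * exitMatrix C r M k' j := by
  have hQ := fun i j => kleeneStar_attained
    (fun p c => (h.smul_block (C := C)).one_le_circuitWeight c) i j
  by_cases h0 : exitMatrix C r M k' j = 0
  · rw [h0, mul_zero]
    exact Tropical.le_zero _
  obtain ⟨l, hl⟩ := exists_mul_apply_eq h0
  change exitMatrix C r M k' j = _ at hl
  obtain ⟨m, hm⟩ := (hQ k' l).2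
  refine (mul_apply_le _ _ _ l _).trans ?_
  rw [hl, ← mul_assoc]
  refine mul_le_mul_left (((hQ k l).1 (m + 1)).trans ?_) _
  rw [pow_succ', hm]
  refine (mul_apply_le _ _ _ k' _).trans_eq ?_
  rw [Matrix.smul_apply, block_apply_of_mem hk hk', smul_eq_mul]

/-- The potential inequalities add up along a walk in `C`, and overall equality forces every arc to
be tight. -/
theorem IsPotential.pow_tight (h : IsPotential M (fun _ => r) u) (m : ℕ) {k l : Fin n} {x : ℝ}
    (hx : ((ofReal (-r) • block C C M) ^ m) k l = ofReal x) :
    u k ≤ x + u l ∧ (u k = x + u l → ReflTransGen (Tight M (fun _ => r) u) k l) := by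
  induction m generalizing k x with
  | zero =>
    by_cases hkl : k = l
    · subst hkl
      rw [pow_zero, Matrix.one_apply_eq, ← ofReal_zero, ofReal_inj] at hx
      subst hx
      simp [ReflTransGen.refl]
    · rw [pow_zero, Matrix.one_apply_ne hkl] at hx
      exact absurd hx.symm (ofReal_ne_zero _)
  | succ m ih =>
    rw [pow_succ'] at hx
    obtain ⟨i, hi⟩ := exists_mul_apply_eq (hx ▸ ofReal_ne_zero x)
    rw [hx] at hi
    obtain ⟨y, z, hy, hz, rfl⟩ := mul_eq_ofReal.1 hi.symm
    rw [smul_block_eq_ofReal] at hy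
    have h1 := h k i _ hy.2
    obtain ⟨h2, h3⟩ := ih hz
    refine ⟨by linarith, fun he => ReflTransGen.head ?_ (h3 (by linarith))⟩
    rw [Tight, hy.2]
    congr 1
    linarith

theorem IsPotential.exitMatrix_tight (h : IsPotential M (fun _ => r) u) {k j : Fin n} {x : ℝ}
    (hx : exitMatrix C r M k j = ofReal x) :
    u k ≤ x + u j ∧ (u k = x + u j → TransGen (Tight M (fun _ => r) u) k j) := by
  obtain ⟨l, hl⟩ := exists_mul_apply_eq (hx ▸ ofReal_ne_zero x : exitMatrix C r M k j ≠ 0)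
  change exitMatrix C r M k j = _ at hl
  rw [hx] at hl
  obtain ⟨y, z, hy, hz, rfl⟩ := mul_eq_ofReal.1 hl.symm
  obtain ⟨m, hm⟩ := (kleeneStar_attained
    (fun p c => (h.smul_block (C := C)).one_le_circuitWeight c) k l).2
  rw [hm] at hy
  rw [smul_block_eq_ofReal] at hz
  obtain ⟨h1, h2⟩ := h.pow_tight m hy
  have h3 := h l j _ hz.2
  refine ⟨by linarith, fun he => TransGen.tail' (h2 (by linarith)) ?_⟩
  rw [Tight, hz.2]
  congr 1
  linarith

/-- A finite entry of the Schur complement comes from an arc or from a path through `C`, so the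
inequalities add up and a tight arc unfolds into a tight path of `M`. -/
theorem IsPotential.schur (h : IsPotential M (fun _ => r) u) :
    IsPotential (schur C r M) (fun _ => r) u ∧
      ∀ i j, Tight (MinPlus.schur C r M) (fun _ => r) u i j →
        TransGen (Tight M (fun _ => r) u) i j := by
  constructor
  · intro i j x hx
    rcases (schur_apply_cases hx).2 with h1 | ⟨k, -, y, z, hy, hz, rfl⟩
    · exact h i j x h1
    · linarith [h i k y hy, (h.exitMatrix_tight hz).1]
  · intro i j hij
    rcases (schur_apply_cases hij).2 with h1 | ⟨k, -, y, z, hy, hz, he⟩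
    · exact TransGen.single h1
    · have h1 := h i k y hy
      obtain ⟨h2, h3⟩ := h.exitMatrix_tight hz
      refine TransGen.head ?_ (h3 (by linarith))
      rw [Tight, hy]
      congr 1
      linarith

/-- Elimination of the nodes of `C` from paths. -/
theorem transGen_elim {E F Q : Fin n → Fin n → Prop}
    (h1 : ∀ i j, i ∉ C → j ∉ C → E i j → F i j)
    (h2 : ∀ i k, i ∉ C → k ∈ C → E i k → Q i k)
    (h3 : ∀ i k k', k ∈ C → k' ∈ C → Q i k → E k k' → Q i k')
    (h4 : ∀ i k j, i ∉ C → k ∈ C → j ∉ C → Q i k → E k j → F i j)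
    {i j : Fin n} (hi : i ∉ C) (hj : j ∉ C) (h : TransGen E i j) : TransGen F i j := by
  -- While the path stays in `C`, `Q` remembers the node `i'` from which `C` was last entered.
  suffices (j ∉ C → TransGen F i j) ∧ (j ∈ C → ∃ i' ∉ C, ReflTransGen F i i' ∧ Q i' j) from
    this.1 hj
  clear hj
  induction h with
  | @single x hx =>
    exact ⟨fun hj => TransGen.single (h1 _ _ hi hj hx),
      fun hj => ⟨i, hi, ReflTransGen.refl, h2 _ _ hi hj hx⟩⟩
  | @tail x y _ hxy ih =>
    by_cases hx : x ∈ C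
    · obtain ⟨i', hi', hii', hQ⟩ := ih.2 hx
      exact ⟨fun hy => TransGen.tail' hii' (h4 _ _ _ hi' hx hy hQ hxy),
        fun hy => ⟨i', hi', hii', h3 _ _ _ hx hy hQ hxy⟩⟩
    · have := ih.1 hx
      exact ⟨fun hy => this.tail (h1 _ _ hx hy hxy),
        fun hy => ⟨x, hx, this.to_reflTransGen, h2 _ _ hx hy hxy⟩⟩

/-- Finiteness of an exit weight propagates backwards from the first arc of the path that leaves
`C`. -/
theorem IsPotential.exitMatrix_ne_zero (h : IsPotential M (fun _ => r) u) {k j : Fin n}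
    (hk : k ∈ C) (hj : j ∉ C) (hkj : ReflTransGen (graph M).Adj k j) :
    ∃ j' ∉ C, exitMatrix C r M k j' ≠ 0 := by
  induction hkj using ReflTransGen.head_induction_on with
  | refl => exact absurd hk hj
  | @head x y hxy _ ih =>
    obtain ⟨s, hs⟩ := ne_zero_iff.1 (hxy : M x y ≠ 0)
    by_cases hy : y ∈ C
    · obtain ⟨j', hj', hne⟩ := ih hy
      obtain ⟨t, ht⟩ := ne_zero_iff.1 hne
      have := h.exitMatrix_le_mul hk hy j'
      rw [hs, ht, ofReal_mul, ofReal_mul] at this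
      obtain ⟨_, h', -⟩ := le_ofReal.1 this
      exact ⟨j', hj', h' ▸ ofReal_ne_zero _⟩
    · have := h.exitMatrix_le hk hy
      rw [hs, ofReal_mul] at this
      obtain ⟨_, h', -⟩ := le_ofReal.1 this
      exact ⟨y, hy, h' ▸ ofReal_ne_zero _⟩

theorem IsPotential.schur_transGen (h : IsPotential M (fun _ => r) u) {i j : Fin n}
    (hi : i ∉ C) (hj : j ∉ C) (hij : TransGen (graph M).Adj i j) :
    TransGen (graph (MinPlus.schur C r M)).Adj i j := by
  -- `Q i k` encodes a passage from `i` to `k` through `C` without naming a walk: row `i` of the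
  -- complement is bounded by a finite translate of the exit weights from `k`.
  refine transGen_elim (C := C) (E := (graph M).Adj)
    (Q := fun i k => ∃ c : ℝ, ∀ j, MinPlus.schur C r M i j ≤ ofReal c * exitMatrix C r M k j)
    ?_ ?_ ?_ ?_ hi hj hij
  · intro i j hi hj hij
    obtain ⟨s, hs⟩ := ne_zero_iff.1 (hij : M i j ≠ 0)
    obtain ⟨_, h', -⟩ := le_ofReal.1 (hs ▸ schur_apply_le hi hj r M)
    exact (h' ▸ ofReal_ne_zero _ : MinPlus.schur C r M i j ≠ 0)
  · intro i k hi hk hik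
    obtain ⟨s, hs⟩ := ne_zero_iff.1 (hik : M i k ≠ 0)
    exact ⟨s, fun j => hs ▸ schur_apply_le_mul hi hk r M j⟩
  · rintro i k k' hk hk' ⟨c, hc⟩ hkk'
    obtain ⟨s, hs⟩ := ne_zero_iff.1 (hkk' : M k k' ≠ 0)
    refine ⟨c + (-r + s), fun j => (hc j).trans ?_⟩
    have := h.exitMatrix_le_mul hk hk' j
    rw [hs, ofReal_mul] at this
    rw [← ofReal_mul, mul_assoc]
    exact mul_le_mul_right this _
  · rintro i k j hi hk hj ⟨c, hc⟩ hkj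
    obtain ⟨s, hs⟩ := ne_zero_iff.1 (hkj : M k j ≠ 0)
    have := h.exitMatrix_le hk hj
    rw [hs, ofReal_mul] at this
    have := (hc j).trans (mul_le_mul_right this _)
    rw [ofReal_mul] at this
    obtain ⟨_, h', -⟩ := le_ofReal.1 this
    exact (h' ▸ ofReal_ne_zero _ : MinPlus.schur C r M i j ≠ 0)

/-- A potential of a Schur complement extends to a potential of the matrix, without creating new
tight circuits outside `C`. -/
theorem IsPotential.exists_extension (h : IsPotential M (fun _ => r) u)
    (hC : ∀ k ∈ C, ∃ j ∉ C, exitMatrix C r M k j ≠ 0) {d v : Fin n → ℝ}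
    (hv : IsPotential (MinPlus.schur C r M) d v) (hd : ∀ k ∈ C, d k = r) :
    ∃ v', IsPotential M d v' ∧ ∀ i ∉ C, TransGen (Tight M d v') i i →
      TransGen (Tight (MinPlus.schur C r M) d v) i i := by
  set P := exitMatrix C r M with hP
  -- On `C` the extension takes the least value of an exit weight plus `v` at the exit node; it is
  -- finite because each node of `C` has a finite exit.
  have hsum : ∀ k ∈ C, ∃ y, ∑ j ∈ Cᶜ, P k j * ofReal (v j) = ofReal y := by
    intro k hk
    obtain ⟨j, hj, hne⟩ := hC k hk
    obtain ⟨t, ht⟩ := ne_zero_iff.1 hne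
    have := sum_le (fun j => P k j * ofReal (v j)) (Finset.mem_compl.2 hj)
    simp only [ht, ofReal_mul] at this
    obtain ⟨s, hs, -⟩ := le_ofReal.1 this
    exact ⟨s, hs⟩
  choose! y hy using hsum
  set v' : Fin n → ℝ := fun i => if i ∈ C then y i else v i with hv'
  have vC : ∀ k ∈ C, v' k = y k := fun k hk => by simp [hv', hk]
  have vN : ∀ k ∉ C, v' k = v k := fun k hk => by simp [hv', hk]
  have up : ∀ k ∈ C, ∀ j ∉ C, ∀ x, P k j ≤ ofReal x → v' k ≤ x + v' j := by
    intro k hk j hj x hx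
    have := sum_le (fun j => P k j * ofReal (v j)) (Finset.mem_compl.2 hj)
    rw [hy k hk] at this
    have := this.trans (mul_le_mul_left hx _)
    rw [ofReal_mul, ofReal_le_ofReal] at this
    rwa [vC k hk, vN j hj]
  have att : ∀ k ∈ C, ∃ j ∉ C, P k j = ofReal (v' k - v' j) := by
    intro k hk
    obtain ⟨j, hj, he⟩ := exists_sum_eq (hy k hk ▸ ofReal_ne_zero _ :
      ∑ j ∈ Cᶜ, P k j * ofReal (v j) ≠ 0)
    rw [hy k hk] at he
    rw [Finset.mem_compl] at hj
    obtain ⟨s, t, hs, ht, hst⟩ := mul_eq_ofReal.1 he.symm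
    rw [ofReal_inj] at ht
    refine ⟨j, hj, ?_⟩
    rw [hs, vC k hk, vN j hj]
    congr 1
    linarith
  have hv₁ : ∀ i j x, i ∉ C → j ∉ C → MinPlus.schur C r M i j ≤ ofReal x →
      v' i + d i ≤ x + v' j := by
    intro i j x hi hj hx
    obtain ⟨s, hs, hsx⟩ := le_ofReal.1 hx
    rw [vN i hi, vN j hj]
    linarith [hv i j s hs]
  have hpot : IsPotential M d v' := by
    intro i j x hx
    by_cases hi : i ∈ C
    · rw [hd i hi]
      by_cases hj : j ∈ C
      · obtain ⟨l, hl, hjl⟩ := att j hj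
        have := h.exitMatrix_le_mul hi hj l
        rw [← hP, hjl, hx, ofReal_mul, ofReal_mul] at this
        linarith [up i hi l hl _ this]
      · have := h.exitMatrix_le hi hj
        rw [hx, ofReal_mul] at this
        linarith [up i hi j hj _ this]
    · by_cases hj : j ∈ C
      · obtain ⟨l, hl, hjl⟩ := att j hj
        have := schur_apply_le_mul hi hj r M l
        rw [← hP, hjl, hx, ofReal_mul] at this
        linarith [hv₁ i l _ hi hl this]
      · exact hv₁ i j x hi hj (hx ▸ schur_apply_le hi hj r M)
  refine ⟨v', hpot, fun i hi hii => ?_⟩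
  -- The opposite inequality is the potential property of `v`, so an upper bound suffices for
  -- tightness.
  have tight_of_le : ∀ i j, i ∉ C → j ∉ C →
      MinPlus.schur C r M i j ≤ ofReal (v' i + d i - v' j) →
      Tight (MinPlus.schur C r M) d v i j := by
    intro i j hi hj hle
    obtain ⟨s, hs, hsx⟩ := le_ofReal.1 hle
    have h1 := hv i j s hs
    rw [Tight, hs]
    rw [vN i hi, vN j hj] at hsx
    congr 1
    linarith
  -- Here `Q i k` bounds row `i` of the complement by the exit weights from `k` plus `v' i + d i -
  -- v' k`, the cost of reaching `k` along tight arcs.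
  refine transGen_elim (C := C) (E := Tight M d v')
    (Q := fun i k => ∀ j, MinPlus.schur C r M i j ≤ ofReal (v' i + d i - v' k) * P k j)
    ?_ ?_ ?_ ?_ hi hi hii
  · intro i j hi hj hij
    exact tight_of_le i j hi hj (hij ▸ schur_apply_le hi hj r M)
  · intro i k hi hk hik j
    exact hik ▸ schur_apply_le_mul hi hk r M j
  · intro i k k' hk hk' hQ hkk' j
    refine (hQ j).trans ?_
    have := h.exitMatrix_le_mul hk hk' j
    rw [hkk', ofReal_mul, hd k hk] at this
    refine (mul_le_mul_right this _).trans_eq ?_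
    rw [← mul_assoc, ofReal_mul]
    congr 2
    ring
  · intro i k j hi hk hj hQ hkj
    refine tight_of_le i j hi hj ((hQ j).trans ?_)
    have := h.exitMatrix_le hk hj
    rw [hkj, ofReal_mul, hd k hk] at this
    refine (mul_le_mul_right this _).trans_eq ?_
    rw [ofReal_mul]
    congr 1
    ring

end Schur

/-! ### The successive levels, and the circuits of the saturation graphs. -/

section Levels

open Relation

variable {n : ℕ}

theorem schur_support {C : Finset (Fin n)} {r : ℝ} {M : Matrix (Fin n) (Fin n) Rmin}
    {i j : Fin n} (h : schur C r M i j ≠ 0) : (∃ k, M i k ≠ 0) ∧ ∃ l, M l j ≠ 0 := by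
  obtain ⟨x, hx⟩ := ne_zero_iff.1 h
  rcases (schur_apply_cases hx).2 with h1 | ⟨k, -, y, z, hy, hz, -⟩
  · exact ⟨⟨j, h1 ▸ ofReal_ne_zero _⟩, ⟨i, h1 ▸ ofReal_ne_zero _⟩⟩
  · refine ⟨⟨k, hy ▸ ofReal_ne_zero _⟩, ?_⟩
    obtain ⟨l, hl⟩ := exists_mul_apply_eq (hz ▸ ofReal_ne_zero z : exitMatrix C r M k j ≠ 0)
    change exitMatrix C r M k j = _ at hl
    rw [hz] at hl
    obtain ⟨_, _, -, hb, -⟩ := mul_eq_ofReal.1 hl.symm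
    rw [smul_block_eq_ofReal] at hb
    exact ⟨l, hb.2 ▸ ofReal_ne_zero _⟩

theorem Tight.ne_zero {M : Matrix (Fin n) (Fin n) Rmin} {d u : Fin n → ℝ} {i j : Fin n}
    (h : Tight M d u i j) : M i j ≠ 0 := by
  rw [Tight] at h
  exact h ▸ ofReal_ne_zero _

variable {A : Matrix (Fin n) (Fin n) Rmin}

theorem nodesBefore_succ (A : Matrix (Fin n) (Fin n) Rmin) (m : ℕ) :
    nodesBefore A (m + 1) = levelNodes A m ∪ nodesBefore A m := by
  rw [nodesBefore, Finset.range_add_one, Finset.biUnion_insert]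
  rfl

theorem mem_nodesBefore {m : ℕ} {i : Fin n} :
    i ∈ nodesBefore A m ↔ ∃ l < m, i ∈ levelNodes A l := by
  simp [nodesBefore]

theorem mem_nodesFrom {m : ℕ} {i : Fin n} : i ∈ nodesFrom A m ↔ i ∉ nodesBefore A m := by
  simp [nodesFrom]

theorem mem_nodesFrom_succ {m : ℕ} {i : Fin n} :
    i ∈ nodesFrom A (m + 1) ↔ i ∉ levelNodes A m ∧ i ∈ nodesFrom A m := by
  simp [mem_nodesFrom, nodesBefore_succ]

theorem nodesFrom_nonempty {m : ℕ} (hm : m < numLevels A) : (nodesFrom A m).Nonempty := by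
  have : nodesBefore A m ≠ Finset.univ := Nat.notMem_of_lt_sInf hm
  rw [Finset.nonempty_iff_ne_empty]
  intro h
  exact this (Finset.compl_eq_empty_iff _ |>.1 h)

theorem rhoMin_eq_ofReal_rhoReal {M : Matrix (Fin n) (Fin n) Rmin} (h : rhoMin M ≠ 0) :
    rhoMin M = ofReal (rhoReal M) := by
  obtain ⟨r, hr⟩ := ne_zero_iff.1 h
  rw [rhoReal, hr]
  rfl

/-- The matrix of level `m` lives on the remaining nodes, and is irreducible there. -/
structure LevelIrred (A : Matrix (Fin n) (Fin n) Rmin) (m : ℕ) : Prop where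
  support : ∀ i j, levelMatrix A m i j ≠ 0 → i ∈ nodesFrom A m ∧ j ∈ nodesFrom A m
  irred : ∀ i ∈ nodesFrom A m, ∀ j ∈ nodesFrom A m, TransGen (graph (levelMatrix A m)).Adj i j

theorem LevelIrred.rhoMin_eq {m : ℕ} (h : LevelIrred A m) (hm : m < numLevels A) :
    rhoMin (levelMatrix A m) = ofReal (critVal A m) := by
  refine rhoMin_eq_ofReal_rhoReal ?_
  obtain ⟨i₀, hi₀⟩ := nodesFrom_nonempty hm
  refine rhoMin_ne_zero (P := (· ∈ nodesFrom A m)) hi₀ fun i hi => ?_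
  obtain ⟨j, hij, -⟩ := TransGen.head'_iff.1 (h.irred i hi i hi)
  exact ⟨j, (h.support i j hij).2, hij⟩

theorem LevelIrred.exists_isPotential {m : ℕ} (h : LevelIrred A m) (hm : m < numLevels A) :
    ∃ u, IsPotential (levelMatrix A m) (fun _ => critVal A m) u :=
  MinPlus.exists_isPotential (h.rhoMin_eq hm)

theorem LevelIrred.levelNodes_subset {m : ℕ} (h : LevelIrred A m) (hm : m < numLevels A) :
    levelNodes A m ⊆ nodesFrom A m := by
  obtain ⟨u, hu⟩ := h.exists_isPotential hm
  intro i hi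
  rw [levelNodes, hu.mem_criticalNodes_iff (h.rhoMin_eq hm)] at hi
  obtain ⟨j, hij, -⟩ := TransGen.head'_iff.1 hi
  exact (h.support i j hij.ne_zero).1

theorem levelIrred (hA : IsIrred A) {m : ℕ} (hm : m < numLevels A) : LevelIrred A m := by
  induction m with
  | zero =>
    refine ⟨fun i j _ => ?_, fun i _ j _ => hA i j⟩
    simp [mem_nodesFrom, nodesBefore]
  | succ m ih =>
    have h := ih (by omega)
    obtain ⟨u, hu⟩ := h.exists_isPotential (by omega)
    constructor
    · intro i j hij
      obtain ⟨x, hx⟩ := ne_zero_iff.1 hij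
      obtain ⟨hi, hj⟩ := (schur_apply_cases hx).1
      obtain ⟨⟨k, hk⟩, l, hl⟩ := schur_support hij
      exact ⟨mem_nodesFrom_succ.2 ⟨hi, (h.support _ _ hk).1⟩,
        mem_nodesFrom_succ.2 ⟨hj, (h.support _ _ hl).2⟩⟩
    · intro i hi j hj
      rw [mem_nodesFrom_succ] at hi hj
      exact hu.schur_transGen hi.1 hj.1 (h.irred i hi.2 j hj.2)

theorem levelNodes_nonempty (hA : IsIrred A) {m : ℕ} (hm : m < numLevels A) :
    (levelNodes A m).Nonempty := by
  have h := (levelIrred hA hm).rhoMin_eq hm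
  obtain ⟨p, c, hc⟩ := exists_isCriticalCircuit (h ▸ ofReal_ne_zero _ : rhoMin (levelMatrix A m) ≠ 0)
  refine ⟨c 0, ?_⟩
  simp only [levelNodes, criticalNodes, Finset.mem_filter, Finset.mem_univ, true_and]
  exact ⟨p, c, hc, 0, rfl⟩

theorem le_rhoMin {M : Matrix (Fin n) (Fin n) Rmin} {r t : ℝ} {u : Fin n → ℝ}
    (h : IsPotential M (fun _ => r) u) (hM : rhoMin M = ofReal t) : r ≤ t := by
  obtain ⟨p, c, hc⟩ := exists_circuitMean_eq_rhoMin (hM ▸ ofReal_ne_zero _)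
  rw [hM, circuitMean_eq_ofReal_iff] at hc
  have := h.le_circuitWeight c
  rw [hc, ofReal_le_ofReal] at this
  simp only [Finset.sum_const, Finset.card_univ, Fintype.card_fin, nsmul_eq_mul, Nat.cast_add,
    Nat.cast_one] at this
  exact le_of_mul_le_mul_left this (by positivity)

theorem levelMatrix_succ (A : Matrix (Fin n) (Fin n) Rmin) (m : ℕ) :
    levelMatrix A (m + 1) = schur (levelNodes A m) (critVal A m) (levelMatrix A m) := rfl

/-- A potential of `A_m` remains one for its Schur complement, whence `≤`. In case of equality, a
critical circuit of `A_{m+1}` would unfold into a tight circuit of `A_m`, whose nodes lie in `C_m`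
and have been removed. -/
theorem critVal_lt_succ (hA : IsIrred A) {m : ℕ} (hm : m + 1 < numLevels A) :
    critVal A m < critVal A (m + 1) := by
  have h := levelIrred hA (m := m) (by omega)
  have h' := levelIrred hA hm
  obtain ⟨u, hu⟩ := h.exists_isPotential (by omega)
  have hρ := h'.rhoMin_eq hm
  obtain ⟨hS, hT⟩ := hu.schur (C := levelNodes A m)
  rw [← levelMatrix_succ] at hS hT
  refine (le_rhoMin hS hρ).lt_of_ne fun he => ?_
  obtain ⟨i, hi⟩ := levelNodes_nonempty hA hm
  have hiN := h'.levelNodes_subset hm hi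
  rw [mem_nodesFrom_succ] at hiN
  rw [levelNodes, hS.mem_criticalNodes_iff (he ▸ hρ)] at hi
  refine hiN.1 ?_
  rw [levelNodes, hu.mem_criticalNodes_iff (h.rhoMin_eq (by omega))]
  exact TransGen.closed (fun _ _ => hT _ _) _ _ hi

theorem critVal_lt (hA : IsIrred A) {m l : ℕ} (hml : m < l) (hl : l < numLevels A) :
    critVal A m < critVal A l := by
  induction l, hml using Nat.le_induction with
  | base => exact critVal_lt_succ hA hl
  | succ l hml ih => exact (ih (by omega)).trans (critVal_lt_succ hA hl)

theorem levelOf_eq (hA : IsIrred A) {m : ℕ} (hm : m < numLevels A) {i : Fin n}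
    (hi : i ∈ levelNodes A m) : levelOf A i = m := by
  refine IsLeast.csInf_eq ⟨hi, fun l hl => ?_⟩
  by_contra! hlt
  have := (levelIrred hA hm).levelNodes_subset hm hi
  exact mem_nodesFrom.1 this (mem_nodesBefore.2 ⟨l, hlt, hl⟩)

theorem levelDiag_of_mem_nodesFrom {l : ℕ} {i : Fin n} (hi : i ∈ nodesFrom A l) :
    levelDiag A l i = critVal A l := if_pos hi

theorem levelDiag_of_mem_levelNodes (hA : IsIrred A) {m l : ℕ} (hml : m ≤ l)
    (hl : l < numLevels A) {i : Fin n} (hi : i ∈ levelNodes A m) :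
    levelDiag A l i = critVal A m := by
  rcases hml.eq_or_lt with rfl | hml
  · exact levelDiag_of_mem_nodesFrom ((levelIrred hA hl).levelNodes_subset hl hi)
  · rw [levelDiag, if_neg, levelOf_eq hA (hml.trans hl) hi]
    rw [mem_nodesFrom, not_not]
    exact mem_nodesBefore.2 ⟨m, hml, hi⟩

theorem levelDiag_lt (hA : IsIrred A) {l : ℕ} (hl : l < numLevels A) {i : Fin n}
    (hi : i ∉ nodesFrom A l) : levelDiag A l i < critVal A l := by
  rw [mem_nodesFrom, not_not] at hi
  obtain ⟨m, hm, him⟩ := mem_nodesBefore.1 hi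
  rw [levelDiag_of_mem_levelNodes hA hm.le hl him]
  exact critVal_lt hA hm hl

theorem levelDiag_eq_of_le (hA : IsIrred A) {l k : ℕ} (hlk : l ≤ k) (hk : k < numLevels A)
    {i : Fin n} (hi : i ∈ nodesBefore A (l + 1)) : levelDiag A k i = levelDiag A l i := by
  obtain ⟨m, hm, him⟩ := mem_nodesBefore.1 hi
  rw [levelDiag_of_mem_levelNodes hA (by omega) hk him,
    levelDiag_of_mem_levelNodes hA (by omega) (by omega) him]

/-- The matrix `Â_ℓ` has a potential, whose tight circuits lie in the first levels. -/
theorem exists_potential_levelDiag (hA : IsIrred A) {l : ℕ} (hl : l < numLevels A) :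
    ∃ u, IsPotential A (levelDiag A l) u ∧
      ∀ i, TransGen (Tight A (levelDiag A l) u) i i → i ∈ nodesBefore A (l + 1) := by
  -- Induction from level `l` back to level `0`; `t` counts the Schur complements undone.
  have key : ∀ t m, m + t = l → ∃ v, IsPotential (levelMatrix A m) (levelDiag A l) v ∧
      ∀ i ∈ nodesFrom A l, TransGen (Tight (levelMatrix A m) (levelDiag A l) v) i i →
        i ∈ levelNodes A l := by
    intro t
    induction t with
    | zero =>
      rintro m rfl
      have h := levelIrred hA hl
      obtain ⟨u, hu⟩ := h.exists_isPotential hl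
      refine ⟨u, fun i j x hx => ?_, fun i _ hii => ?_⟩
      · rw [levelDiag_of_mem_nodesFrom (h.support i j (hx ▸ ofReal_ne_zero x)).1]
        exact hu i j x hx
      · rw [levelNodes, hu.mem_criticalNodes_iff (h.rhoMin_eq hl)]
        refine TransGen.mono (fun i j hij => ?_) _ _ hii
        have := (h.support i j hij.ne_zero).1
        rwa [Tight, levelDiag_of_mem_nodesFrom this] at hij
    | succ t ih =>
      intro m hm
      obtain ⟨v, hv, hvt⟩ := ih (m + 1) (by omega)
      have hmk : m < numLevels A := by omega
      have h := levelIrred hA hmk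
      obtain ⟨u, hu⟩ := h.exists_isPotential hmk
      obtain ⟨j, hj⟩ := nodesFrom_nonempty (A := A) (m := m + 1) (by omega)
      rw [mem_nodesFrom_succ] at hj
      obtain ⟨v', hv', ht⟩ := hu.exists_extension (C := levelNodes A m)
        (fun k hk => hu.exitMatrix_ne_zero hk hj.1
          (h.irred k (h.levelNodes_subset hmk hk) j hj.2).to_reflTransGen) hv
        (fun k hk => levelDiag_of_mem_levelNodes hA (by omega) hl hk)
      refine ⟨v', hv', fun i hi hii => hvt i hi (ht i (fun hiC => ?_) hii)⟩
      exact mem_nodesFrom.1 hi (mem_nodesBefore.2 ⟨m, by omega, hiC⟩)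
  obtain ⟨v, hv, hvt⟩ := key l 0 (by simp)
  refine ⟨v, hv, fun i hi => ?_⟩
  rw [nodesBefore_succ, Finset.mem_union]
  by_cases hil : i ∈ nodesFrom A l
  · exact Or.inl (hvt i hil hi)
  · exact Or.inr (by simpa [mem_nodesFrom] using hil)

/-! ### The matrices `Â_ℓ` -/

theorem hat_apply (A : Matrix (Fin n) (Fin n) Rmin) (l : ℕ) (i j : Fin n) :
    hat A l i j = ofReal (-levelDiag A l i) * A i j := by
  rw [hat, Matrix.diagonal_mul]

theorem hat_eq_ofReal {l : ℕ} {i j : Fin n} {x : ℝ} :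
    hat A l i j = ofReal x ↔ A i j = ofReal (x + levelDiag A l i) := by
  rw [hat_apply, ofReal_mul_eq_ofReal, sub_neg_eq_add]

theorem isPotential_hat_iff {l : ℕ} {u : Fin n → ℝ} :
    IsPotential (hat A l) (fun _ => 0) u ↔ IsPotential A (levelDiag A l) u := by
  constructor
  · intro h i j x hx
    have := h i j (x - levelDiag A l i) (by rw [hat_eq_ofReal, hx, sub_add_cancel])
    linarith
  · intro h i j x hx
    have := h i j _ (hat_eq_ofReal.1 hx)
    linarith

theorem tight_hat {l : ℕ} {u : Fin n → ℝ} :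
    Tight (hat A l) (fun _ => 0) u = Tight A (levelDiag A l) u := by
  ext i j
  rw [Tight, hat_eq_ofReal, Tight]
  congr! 2
  ring

/-- A circuit which is critical for `A` has weight `0` in `Â_ℓ`. -/
theorem exists_circuit_hat (hA : IsIrred A) {l : ℕ} (hl : l < numLevels A) :
    ∃ (p : Fin n) (c : Fin ((p : ℕ) + 1) → Fin n), circuitWeight (hat A l) c = ofReal 0 := by
  have h0 : 0 < numLevels A := by omega
  have h := levelIrred hA h0
  obtain ⟨u, hu⟩ := h.exists_isPotential h0
  have hρ := h.rhoMin_eq h0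
  obtain ⟨p, c, hc⟩ := exists_isCriticalCircuit (hρ ▸ ofReal_ne_zero _ : rhoMin (levelMatrix A 0) ≠ 0)
  -- Level `0` is convenient: on its critical nodes the offset is the same for every `l`.
  have hcd : ∀ m, levelDiag A l (c m) = critVal A 0 := by
    intro m
    refine levelDiag_of_mem_levelNodes hA (Nat.zero_le l) hl ?_
    simp only [levelNodes, criticalNodes, Finset.mem_filter, Finset.mem_univ, true_and]
    exact ⟨p, c, hc, m, rfl⟩
  rw [hu.isCriticalCircuit_iff hρ] at hc
  refine ⟨p, c, ?_⟩
  have : ∀ m, hat A l (c m) (c (m + 1)) = ofReal (u (c m) - u (c (m + 1))) := by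
    intro m
    have h1 : A (c m) (c (m + 1)) = _ := hc m
    rw [hat_eq_ofReal, h1, hcd]
    congr 1
    ring
  rw [circuitWeight, Finset.prod_congr rfl fun m _ => this m, prod_ofReal]
  have := sum_circuit_gap (fun _ => 0) u c
  simp only [add_zero, Finset.sum_const_zero] at this
  rw [this]

theorem rhoMin_hat (hA : IsIrred A) {l : ℕ} (hl : l < numLevels A) :
    rhoMin (hat A l) = ofReal 0 := by
  obtain ⟨u, hu, -⟩ := exists_potential_levelDiag hA hl
  rw [← isPotential_hat_iff] at hu
  obtain ⟨p, c, hc⟩ := exists_circuit_hat hA hl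
  have hle : rhoMin (hat A l) ≤ ofReal 0 := by
    refine (rhoMin_le_circuitMean _ p c).trans_eq ?_
    rw [circuitMean_eq_ofReal_iff, hc, mul_zero]
  refine le_antisymm hle ?_
  obtain ⟨s, hs, -⟩ := le_ofReal.1 hle
  obtain ⟨q, c', hc'⟩ := exists_circuitMean_eq_rhoMin (hs ▸ ofReal_ne_zero s)
  rw [← hc', ofReal_le_circuitMean_iff]
  simpa using hu.le_circuitWeight c'

theorem mulVec_le (M : Matrix (Fin n) (Fin n) Rmin) (V : Fin n → Rmin) (i j : Fin n) :
    (M *ᵥ V) i ≤ M i j * V j :=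
  sum_le (fun j => M i j * V j) (Finset.mem_univ j)

theorem exists_mulVec_eq {M : Matrix (Fin n) (Fin n) Rmin} {V : Fin n → Rmin} {i : Fin n}
    (h : (M *ᵥ V) i ≠ 0) : ∃ j, (M *ᵥ V) i = M i j * V j := by
  obtain ⟨j, -, hj⟩ := exists_sum_eq (s := Finset.univ) (f := fun j => M i j * V j) h
  exact ⟨j, hj⟩

/-- The eigenvectors of `Â_ℓ` are finite, for the eigenvalue `0`; their saturation graph is made
of their tight arcs. -/
theorem IsEigenvector.exists_potential (hA : IsIrred A) {l : ℕ} (hl : l < numLevels A)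
    {V : Fin n → Rmin} (hV : IsEigenvector (hat A l) V) :
    ∃ v : Fin n → ℝ, (∀ i, V i = ofReal (v i)) ∧ IsPotential A (levelDiag A l) v ∧
      (satGraph (hat A l) V).Adj = Tight A (levelDiag A l) v := by
  obtain ⟨hV0, lam, hlam⟩ := hV
  have hl' : ∀ i, (hat A l *ᵥ V) i = lam * V i := fun i => congrFun hlam i
  -- Finiteness passes backwards along arcs, so by irreducibility it spreads from one node to all.
  have harc : ∀ i j, A i j ≠ 0 → V j ≠ 0 → lam * V i ≠ 0 := by
    intro i j hij hj
    obtain ⟨x, hx⟩ := ne_zero_iff.1 hij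
    obtain ⟨y, hy⟩ := ne_zero_iff.1 hj
    have := mulVec_le (hat A l) V i j
    rw [hl', hat_apply, hx, hy, ofReal_mul, ofReal_mul] at this
    obtain ⟨s, hs, -⟩ := le_ofReal.1 this
    exact hs ▸ ofReal_ne_zero s
  obtain ⟨i₀, hi₀⟩ : ∃ i, V i ≠ 0 := by
    by_contra! h
    exact hV0 (funext h)
  have hfin : ∀ i, lam * V i ≠ 0 := by
    intro i
    have hi := hA i i₀
    induction hi using TransGen.head_induction_on with
    | single h => exact harc _ _ h hi₀
    | head h _ ih => exact harc _ _ h (right_ne_zero_of_mul ih)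
  choose v hv using fun i => ne_zero_iff.1 (right_ne_zero_of_mul (hfin i))
  obtain ⟨t, rfl⟩ := ne_zero_iff.1 (left_ne_zero_of_mul (hfin i₀))
  simp only [hv, ofReal_mul] at hl'
  have hpot : IsPotential (hat A l) (fun _ => t) v := by
    intro i j x hx
    have := mulVec_le (hat A l) V i j
    rw [hl', hx, hv, ofReal_mul, ofReal_le_ofReal] at this
    linarith
  obtain ⟨u, hu, -⟩ := exists_potential_levelDiag hA hl
  rw [← isPotential_hat_iff] at hu
  -- A circuit of weight `0` has weight at least its length times `t`.
  have ht0 : t ≤ 0 := by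
    obtain ⟨p, c, hc⟩ := exists_circuit_hat hA hl
    have := hpot.le_circuitWeight c
    rw [hc, ofReal_le_ofReal] at this
    simp only [Finset.sum_const, Finset.card_univ, Fintype.card_fin, nsmul_eq_mul, Nat.cast_add,
      Nat.cast_one] at this
    by_contra! h
    have : 0 < ((p : ℕ) + 1 : ℝ) * t := by positivity
    linarith
  -- Maximum principle: where `u - v` is maximal, follow an arc attaining the minimum in the
  -- eigenvalue equation.
  have ht1 : 0 ≤ t := by
    obtain ⟨i, -, hi⟩ := Finset.exists_max_image Finset.univ (fun i => u i - v i) ⟨i₀, by simp⟩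
    obtain ⟨j, hj⟩ := exists_mulVec_eq (hl' i ▸ ofReal_ne_zero _)
    rw [hl', hv] at hj
    obtain ⟨x, y, hx, hy, hxy⟩ := mul_eq_ofReal.1 hj.symm
    rw [ofReal_inj] at hy
    have h1 := hu i j x hx
    have h2 := hi j (Finset.mem_univ j)
    linarith
  obtain rfl : t = 0 := le_antisymm ht0 ht1
  refine ⟨v, hv, isPotential_hat_iff.1 hpot, ?_⟩
  rw [← tight_hat]
  ext i j
  change (hat A l *ᵥ V) i = hat A l i j * V j ↔ _
  rw [hl', hv, eq_comm, mul_comm, ofReal_mul_eq_ofReal, Tight]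
  congr! 2
  ring

/-! ### Circuits of saturation graphs -/

/-- The arcs of a circuit of `R` belong to a circuit of such arcs. -/
theorem reflTransGen_cyclic {α : Type*} {R : α → α → Prop} {i j : α} (hij : R i j)
    (hji : ReflTransGen R j i) :
    ReflTransGen (fun x y => R x y ∧ ReflTransGen R y x) j i := by
  suffices ∀ y, ReflTransGen R j y → ReflTransGen R y i →
      ReflTransGen (fun x y => R x y ∧ ReflTransGen R y x) j y from this i hji ReflTransGen.refl
  intro y hjy
  induction hjy with
  | refl => exact fun _ => ReflTransGen.refl
  | @tail x y hjx hxy ih =>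
    intro hyi
    exact (ih (hyi.head hxy)).tail ⟨hxy, (hyi.tail hij).trans hjx⟩

/-- A function that never decreases along arcs cannot increase on a circuit. -/
theorem eq_of_circuit_of_monotone {α : Type*} {R : α → α → Prop} {f : α → ℝ}
    (hf : ∀ i j, R i j → f i ≤ f j) {i j : α} (hij : R i j) (hji : ReflTransGen R j i) :
    f i = f j := by
  refine le_antisymm (hf i j hij) ?_
  clear hij
  induction hji with
  | refl => exact le_rfl
  | tail _ h ih => exact ih.trans (hf _ _ h)

/-- Circuits on which two potentials can be compared are tight for both. -/
theorem tight_of_circuit {M : Matrix (Fin n) (Fin n) Rmin} {d d' u v : Fin n → ℝ}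
    (hv : IsPotential M d' v) {R : Fin n → Fin n → Prop}
    (hR : ∀ i j, R i j → Tight M d u i j ∧ d i = d' i) {i j : Fin n} (hij : R i j)
    (hji : ReflTransGen R j i) : Tight M d' v i j := by
  -- Where `u` is tight and the offsets agree, the inequality for `v` says that `v - u` does not
  -- decrease along the arc.
  have h := eq_of_circuit_of_monotone (R := R) (f := fun i => v i - u i)
    (fun i j hij => by
      obtain ⟨h1, h2⟩ := hR i j hij
      have := hv i j _ h1
      linarith) hij hji
  obtain ⟨h1, h2⟩ := hR i j hij
  rw [Tight, h1]
  congr 1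
  linarith

/-- The graphs `G^c(Â)` and `Sat(Â, U)`, once restricted to the nodes of the levels up to `ℓ`,
have the same circuits as `Sat(Â_ℓ, V)`. -/
theorem circuits_satGraph (hA : IsIrred A) {G : Digraph (Fin n)}
    (hG : G = criticalGraph (hatLast A) ∨
      ∃ U : Fin n → Rmin, IsEigenvector (hatLast A) U ∧ G = satGraph (hatLast A) U)
    {l : ℕ} (hl : l < numLevels A) {V : Fin n → Rmin} (hV : IsEigenvector (hat A l) V) :
    (∀ i j, (satGraph (hat A l) V).Adj i j → ReflTransGen (satGraph (hat A l) V).Adj j i →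
      G.Adj i j ∧ i ∈ nodesBefore A (l + 1) ∧ j ∈ nodesBefore A (l + 1)) ∧
    ∀ i j, (G.Adj i j ∧ i ∈ nodesBefore A (l + 1) ∧ j ∈ nodesBefore A (l + 1)) →
      ReflTransGen (fun i j => G.Adj i j ∧ i ∈ nodesBefore A (l + 1) ∧
        j ∈ nodesBefore A (l + 1)) j i → (satGraph (hat A l) V).Adj i j := by
  have hk : numLevels A - 1 < numLevels A := by omega
  obtain ⟨v, -, hv, hvT⟩ := hV.exists_potential hA hl
  obtain ⟨u₀, hu₀, hu₀T⟩ := exists_potential_levelDiag hA hl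
  -- For either choice, `G` consists of tight arcs of one potential of `Â` and contains every such
  -- arc lying on a tight circuit. Only this is used below.
  obtain ⟨u, hu, hGT, hTG⟩ : ∃ u, IsPotential A (levelDiag A (numLevels A - 1)) u ∧
      (∀ i j, G.Adj i j → Tight A (levelDiag A (numLevels A - 1)) u i j) ∧
      (∀ i j, Tight A (levelDiag A (numLevels A - 1)) u i j →
        ReflTransGen (Tight A (levelDiag A (numLevels A - 1)) u) j i → G.Adj i j) := by
    rcases hG with rfl | ⟨U, hU, rfl⟩
    · obtain ⟨u, hu, -⟩ := exists_potential_levelDiag hA hk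
      have := (isPotential_hat_iff.2 hu).criticalGraph_adj_iff (rhoMin_hat hA hk)
      rw [tight_hat] at this
      exact ⟨u, hu, fun i j h => ((this i j).1 h).1, fun i j h h' => (this i j).2 ⟨h, h'⟩⟩
    · obtain ⟨u, -, hu, huT⟩ := hU.exists_potential hA hk
      refine ⟨u, hu, fun i j h => ?_, fun i j h _ => ?_⟩
      · rw [← huT]
        exact h
      · rw [← huT] at h
        exact h
  rw [hvT]
  have hdiag : ∀ i ∈ nodesBefore A (l + 1),
      levelDiag A (numLevels A - 1) i = levelDiag A l i := fun i hi =>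
    levelDiag_eq_of_le hA (by omega) hk hi
  refine ⟨fun i j hij hji => ?_, fun i j hij hji => ?_⟩
  · have hcyc := reflTransGen_cyclic hij hji
    -- A tight circuit for `v` is tight for `u₀`, whose tight circuits stay in the first levels.
    have hmem : ∀ x y, Tight A (levelDiag A l) v x y →
        ReflTransGen (Tight A (levelDiag A l) v) y x → x ∈ nodesBefore A (l + 1) := by
      intro x y hxy hyx
      refine hu₀T x (TransGen.head' (b := y) ?_ ?_)
      · exact tight_of_circuit hu₀ (fun _ _ h => ⟨h, rfl⟩) hxy hyx
      · exact ReflTransGen.mono (fun a b hab =>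
          tight_of_circuit hu₀ (fun _ _ h => ⟨h, rfl⟩) hab.1 hab.2) _ _
          (reflTransGen_cyclic hxy hyx)
    -- On those nodes the offsets of `Â_ℓ` and `Â` coincide, so the circuits are also tight for `u`.
    have hT : ∀ x y, Tight A (levelDiag A l) v x y →
        ReflTransGen (Tight A (levelDiag A l) v) y x →
        Tight A (levelDiag A (numLevels A - 1)) u x y := by
      intro x y hxy hyx
      exact tight_of_circuit hu
        (R := fun x y => Tight A (levelDiag A l) v x y ∧
          ReflTransGen (Tight A (levelDiag A l) v) y x)
        (fun a b h => ⟨h.1, (hdiag a (hmem a b h.1 h.2)).symm⟩) ⟨hxy, hyx⟩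
        (reflTransGen_cyclic hxy hyx)
    refine ⟨hTG i j (hT i j hij hji) (ReflTransGen.mono (fun a b h => hT a b h.1 h.2) _ _ hcyc),
      hmem i j hij hji, ?_⟩
    obtain rfl | ⟨k, hjk, hki⟩ := hji.cases_head
    · exact hmem _ _ hij hji
    · exact hmem j k hjk (hki.tail hij)
  · exact tight_of_circuit hv (fun a b h => ⟨hGT a b h.1, hdiag a h.2.1⟩) hij hji

end Levels

/-! ### Determinants, circuits and conventional Schur complements. -/

section Determinants

open Relation

variable {n : ℕ}

/-- Each non-fixed index lies on a cycle of `σ`, and the arcs `(σ i, i)` along that cycle form a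
circuit. -/
theorem circuit_of_perm {G₁ G₂ : Digraph (Fin n)}
    (h : ∀ i j, G₁.Adj i j → ReflTransGen G₁.Adj j i → G₂.Adj i j) {σ : Equiv.Perm (Fin n)}
    (hσ : ∀ i, σ i ≠ i → G₁.Adj (σ i) i) (i : Fin n) (hi : σ i ≠ i) : G₂.Adj (σ i) i := by
  refine h _ _ (hσ i hi) ?_
  have key : ∀ k : ℕ, ReflTransGen G₁.Adj i ((σ⁻¹ ^ k) i) := by
    intro k
    induction k with
    | zero => exact ReflTransGen.refl
    | succ k ih =>
      rw [pow_succ', Equiv.Perm.mul_apply]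
      set x := (σ⁻¹ ^ k) i
      by_cases hx : σ (σ⁻¹ x) = σ⁻¹ x
      · rw [← hx]
        simpa using ih
      · have := hσ (σ⁻¹ x) hx
        rw [show σ (σ⁻¹ x) = x from σ.apply_symm_apply x] at this
        exact ih.tail this
  -- The arcs run along `σ⁻¹`; as `σ` is a power of `σ⁻¹`, following them from `i` leads back to `σ
  -- i`.
  have h1 : σ⁻¹ ^ (orderOf σ - 1) = σ := by
    have h2 : σ⁻¹ ^ (orderOf σ - 1) * σ⁻¹ = 1 := by
      rw [← pow_succ, Nat.sub_add_cancel (orderOf_pos σ), inv_pow, pow_orderOf_eq_one, inv_one]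
    rw [mul_inv_eq_one] at h2
    exact h2
  have := key (orderOf σ - 1)
  rwa [h1] at this

/-- The determinant of `diag(e) - b^G` only depends on the circuits of `G`. -/
theorem det_diagonal_sub_restrictTo {G₁ G₂ : Digraph (Fin n)}
    (h₁ : ∀ i j, G₁.Adj i j → ReflTransGen G₁.Adj j i → G₂.Adj i j)
    (h₂ : ∀ i j, G₂.Adj i j → ReflTransGen G₂.Adj j i → G₁.Adj i j)
    (e : Fin n → ℂ) (b : Matrix (Fin n) (Fin n) ℂ) :
    (diagonal e - restrictTo G₁ b).det = (diagonal e - restrictTo G₂ b).det := by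
  rw [Matrix.det_apply, Matrix.det_apply]
  refine Finset.sum_congr rfl fun σ _ => ?_
  congr 1
  -- Off the diagonal only `b^G` contributes, so a permutation leaving `G` at a non-fixed index
  -- gives a zero product.
  have hvan : ∀ G : Digraph (Fin n), (¬ ∀ i, σ i ≠ i → G.Adj (σ i) i) →
      ∏ i, (diagonal e - restrictTo G b) (σ i) i = 0 := by
    intro G hG
    push Not at hG
    obtain ⟨i, hi, hGi⟩ := hG
    refine Finset.prod_eq_zero (Finset.mem_univ i) ?_
    simp [restrictTo, hGi, hi]
  by_cases hσ : ∀ i, σ i ≠ i → G₁.Adj (σ i) i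
  · have hσ₂ := circuit_of_perm h₁ hσ
    refine Finset.prod_congr rfl fun i _ => ?_
    have : G₁.Adj (σ i) i ↔ G₂.Adj (σ i) i := by
      by_cases hi : σ i = i
      · rw [hi]
        exact ⟨fun h => h₁ i i h ReflTransGen.refl, fun h => h₂ i i h ReflTransGen.refl⟩
      · exact iff_of_true (hσ i hi) (hσ₂ i hi)
    by_cases hG : G₂.Adj (σ i) i
    · simp [restrictTo, hG, this.2 hG]
    · simp [restrictTo, hG, mt this.1 hG]
  · rw [hvan G₁ hσ, hvan G₂ fun h => hσ (circuit_of_perm h₂ h)]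

/-- The partition of the indices into a set and its complement. -/
def sumComplEquiv (C : Finset (Fin n)) : C ⊕ ↥Cᶜ ≃ Fin n :=
  (Equiv.sumCongr (Equiv.refl _) (Equiv.subtypeEquivRight fun _ => Finset.mem_compl)).trans
    (Equiv.sumCompl (· ∈ C))

/-- The parameter `z` is absent from the `C × C` block, so this invertible block can be eliminated
uniformly in `z`. -/
theorem det_smul_diagIndicator_sub {C : Finset (Fin n)} {b : Matrix (Fin n) (Fin n) ℂ}
    (hb : IsUnit (subMat C C b)) (z : ℂ) :
    (z • diagIndicator Cᶜ - b).det =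
      (-subMat C C b).det * (z • (1 : Matrix ↥Cᶜ ↥Cᶜ ℂ) - schurC C b).det := by
  have hu : IsUnit (-subMat C C b) := hb.neg
  have hdet : IsUnit (-subMat C C b).det := (Matrix.isUnit_iff_isUnit_det _).1 hu
  let _ : Invertible (-subMat C C b) := Matrix.invertibleOfIsUnitDet _ hdet
  have hblocks : (z • diagIndicator Cᶜ - b).submatrix (sumComplEquiv C) (sumComplEquiv C) =
      fromBlocks (-subMat C C b) (-subMat C Cᶜ b) (-subMat Cᶜ C b)
        (z • (1 : Matrix ↥Cᶜ ↥Cᶜ ℂ) - subMat Cᶜ Cᶜ b) := by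
    ext x y
    rcases x with ⟨x, hx⟩ | ⟨x, hx⟩ <;> rcases y with ⟨y, hy⟩ | ⟨y, hy⟩
    · simp [sumComplEquiv, diagIndicator, subMat, diagonal_apply, hx]
    · simp [sumComplEquiv, diagIndicator, subMat, diagonal_apply, hx]
    · have hxy : x ≠ y := by
        rintro rfl
        exact Finset.mem_compl.1 hx hy
      simp [sumComplEquiv, diagIndicator, subMat, hxy]
    · have hx' : x ∉ C := Finset.mem_compl.1 hx
      simp [sumComplEquiv, diagIndicator, subMat, diagonal_apply, Matrix.one_apply, hx']
  rw [← Matrix.det_submatrix_equiv_self (sumComplEquiv C), hblocks, Matrix.det_fromBlocks₁₁,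
    Matrix.invOf_eq_nonsing_inv]
  have hinv : (-subMat C C b)⁻¹ = -(subMat C C b)⁻¹ := by
    refine Matrix.inv_eq_right_inv ?_
    rw [neg_mul_neg, Matrix.mul_nonsing_inv _ ((Matrix.isUnit_iff_isUnit_det _).1 hb)]
  rw [hinv, schurC]
  refine congrArg (fun M => (-subMat C C b).det * Matrix.det M) ?_
  rw [Matrix.neg_mul, Matrix.mul_neg, Matrix.mul_neg, Matrix.neg_mul, neg_neg,
    Matrix.neg_mul, sub_neg_eq_add]
  abel

/-- Zero rows make the matrix block triangular; each of them contributes a factor `z`. -/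
theorem det_smul_one_sub_of_rows_eq_zero {ι : Type*} [Fintype ι] [DecidableEq ι]
    (p : ι → Prop) [DecidablePred p] {s : Matrix ι ι ℂ} (hs : ∀ i, ¬ p i → ∀ j, s i j = 0)
    (z : ℂ) : (z • (1 : Matrix ι ι ℂ) - s).det =
      z ^ Fintype.card {i // ¬ p i} *
        (s.submatrix Subtype.val Subtype.val : Matrix {i // p i} {i // p i} ℂ).charpoly.eval z := by
  rw [Matrix.twoBlockTriangular_det _ p, mul_comm]
  · congr 1
    · have : (z • (1 : Matrix ι ι ℂ) - s).toSquareBlockProp (fun i => ¬ p i) =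
          z • (1 : Matrix {i // ¬ p i} {i // ¬ p i} ℂ) := by
        ext x y
        simp [Matrix.toSquareBlockProp, hs x x.2, Matrix.one_apply, Subtype.ext_iff]
      rw [this, Matrix.det_smul, Matrix.det_one, mul_one]
    · rw [Matrix.eval_charpoly]
      congr 1
      ext x y
      simp [Matrix.toSquareBlockProp, Matrix.one_apply, Subtype.ext_iff, Matrix.scalar_apply,
        Matrix.diagonal_apply]
  · intro i hi j hj
    have : i ≠ j := by
      rintro rfl
      exact hi hj
    simp [hs i hi, this]

variable {A : Matrix (Fin n) (Fin n) Rmin}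

/-- The determinant of `λ E_N - a^{Sat(Â_ℓ, V)}` in terms of `r^ℓ` and `t^ℓ`. -/
theorem det_satGraph (hA : IsIrred A) {G : Digraph (Fin n)}
    (hG : G = criticalGraph (hatLast A) ∨
      ∃ U : Fin n → Rmin, IsEigenvector (hatLast A) U ∧ G = satGraph (hatLast A) U)
    {l : ℕ} (hl : l < numLevels A) {V : Fin n → Rmin} (hV : IsEigenvector (hat A l) V)
    (a : Matrix (Fin n) (Fin n) ℂ) (hr : IsUnit (rMat a A G l)) :
    ∃ c : ℂ, c ≠ 0 ∧ ∃ q : ℕ, ∀ z : ℂ,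
      (z • diagIndicator (nodesFrom A l) - restrictTo (satGraph (hat A l) V) a).det =
        c * (z ^ q * (tMat a A G l).charpoly.eval z) := by
  classical
  obtain ⟨h₁, h₂⟩ := circuits_satGraph hA hG hl hV
  set CC := nodesBefore A (l + 1) with hCC
  -- `G` may have further circuits through later levels; its restriction to the levels up to `l` has
  -- exactly those of the saturation graph.
  set G' : Digraph (Fin n) := ⟨fun i j => G.Adj i j ∧ i ∈ CC ∧ j ∈ CC⟩ with hG'
  have hsub : ∀ i ∈ nodesBefore A l, i ∈ CC := fun i hi => by
    rw [hCC, nodesBefore_succ]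
    exact Finset.mem_union_right _ hi
  have hsub' : ∀ i ∈ levelNodes A l, i ∈ CC := fun i hi => by
    rw [hCC, nodesBefore_succ]
    exact Finset.mem_union_left _ hi
  have hmem : ∀ i ∈ CC, i ∈ levelNodes A l ∨ i ∈ nodesBefore A l := fun i hi => by
    rwa [hCC, nodesBefore_succ, Finset.mem_union] at hi
  have hentry : ∀ i ∈ CC, ∀ j ∈ CC, restrictTo G' a i j = restrictTo G a i j := by
    intro i hi j hj
    simp [restrictTo, hG', hi, hj]
  have hzero : ∀ i ∉ CC, ∀ j, restrictTo G' a i j = 0 := by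
    intro i hi j
    simp [restrictTo, hG', hi]
  have hr' : subMat (nodesBefore A l) (nodesBefore A l) (restrictTo G' a) = rMat a A G l := by
    ext i j
    exact hentry _ (hsub _ i.2) _ (hsub _ j.2)
  refine ⟨(-rMat a A G l).det, ?_, ?_⟩
  · exact ((Matrix.isUnit_iff_isUnit_det _).1 hr.neg).ne_zero
  -- The exponent counts the nodes of levels after `l`: their rows vanish in `a^{G'}`, hence in its
  -- Schur complement.
  refine ⟨Fintype.card {i : ↥(nodesBefore A l)ᶜ // ¬ i.1 ∈ levelNodes A l}, fun z => ?_⟩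
  have hdet : (z • diagIndicator (nodesFrom A l) - restrictTo (satGraph (hat A l) V) a).det =
      (z • diagIndicator (nodesBefore A l)ᶜ - restrictTo G' a).det := by
    change (z • diagIndicator (nodesFrom A l) - _).det = (z • diagIndicator (nodesFrom A l) - _).det
    rw [diagIndicator, ← Matrix.diagonal_smul]
    exact det_diagonal_sub_restrictTo (G₂ := G') h₁ h₂ _ _
  rw [hdet, det_smul_diagIndicator_sub (hr' ▸ hr), hr',
    det_smul_one_sub_of_rows_eq_zero (fun i => i.1 ∈ levelNodes A l)]
  · congr 4
    ext i j
    have hi := hsub' _ i.2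
    have hj := hsub' _ j.2
    change schurC (nodesBefore A l) (restrictTo G' a) i.1 j.1 =
      schurC (nodesBefore A l) (restrictTo G a) i.1 j.1
    have hr'' : subMat (nodesBefore A l) (nodesBefore A l) (restrictTo G' a) =
      subMat (nodesBefore A l) (nodesBefore A l) (restrictTo G a) := hr'
    rw [schurC, schurC, hr'']
    simp only [Matrix.sub_apply, Matrix.mul_apply]
    congr 1
    · exact hentry _ hi _ hj
    · refine Finset.sum_congr rfl fun k _ => ?_
      congr 1
      · refine Finset.sum_congr rfl fun m _ => ?_
        congr 1
        exact hentry _ hi _ (hsub _ m.2)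
      · exact hentry _ (hsub _ k.2) _ hj
  · intro i hi j
    have hi' : i.1 ∉ CC := fun h => (hmem _ h).elim hi (Finset.mem_compl.1 i.2)
    simp [schurC, Matrix.mul_apply, subMat, hzero _ hi']

end Determinants

/-! ### Perturbation of simple roots and of kernels. -/

section Analysis

variable {n : ℕ}

theorem rootMultiplicity_eq_one_iff {p : Polynomial ℂ} (hp : p ≠ 0) (x : ℂ) :
    p.rootMultiplicity x = 1 ↔ p.eval x = 0 ∧ p.derivative.eval x ≠ 0 := by
  have h1 := Polynomial.one_lt_rootMultiplicity_iff_isRoot (t := x) hp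
  have h2 := Polynomial.rootMultiplicity_pos (x := x) hp
  simp only [Polynomial.IsRoot] at h1 h2
  constructor
  · intro h
    have h0 := h2.1 (by omega)
    exact ⟨h0, fun h' => by have := h1.2 ⟨h0, h'⟩; omega⟩
  · rintro ⟨h0, h'⟩
    have := h2.2 h0
    have : ¬ 1 < p.rootMultiplicity x := fun h => h' (h1.1 h).2
    omega

/-! ### Kernels and adjugates -/

/-- The kernel of a matrix is read off any nonzero column of its adjugate. -/
theorem mul_adjugate_eq_of_mulVec_eq_zero {M : Matrix (Fin n) (Fin n) ℂ} {x : Fin n → ℂ}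
    (hx : M *ᵥ x = 0) (i j k : Fin n) : x j * M.adjugate i k = x i * M.adjugate j k := by
  by_cases hx0 : x = 0
  · simp [hx0]
  -- The difference of the two sides is the determinant of `M` with row `k` replaced by `x j e_i - x
  -- i e_j`. This row also annihilates `x`, so the new matrix is singular.
  rw [Matrix.adjugate_apply, Matrix.adjugate_apply, ← sub_eq_zero,
    ← Matrix.det_updateRow_smul, ← Matrix.det_updateRow_smul, sub_eq_add_neg,
    ← neg_one_mul, ← Matrix.det_updateRow_smul, ← Matrix.det_updateRow_add]
  refine Matrix.exists_mulVec_eq_zero_iff.1 ⟨x, hx0, ?_⟩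
  ext l
  by_cases hl : l = k
  · subst hl
    simp only [Matrix.mulVec, Matrix.updateRow_self, add_dotProduct, smul_dotProduct,
      single_dotProduct, smul_eq_mul, Pi.zero_apply]
    ring
  · have := congrFun hx l
    simpa [Matrix.mulVec, Matrix.updateRow_ne hl] using this

theorem kernel_of_adjugate_ne_zero {M : Matrix (Fin n) (Fin n) ℂ} (hdet : M.det = 0)
    (hadj : M.adjugate ≠ 0) :
    ∃ w : Fin n → ℂ, w ≠ 0 ∧ M *ᵥ w = 0 ∧ ∀ w', M *ᵥ w' = 0 → ∃ z : ℂ, w' = z • w := by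
  obtain ⟨i, k, hik⟩ : ∃ i k, M.adjugate i k ≠ 0 := by
    by_contra! h
    exact hadj (by ext i k; exact h i k)
  refine ⟨fun j => M.adjugate j k, fun h => hik (congrFun h i), ?_, fun w' hw' => ?_⟩
  · ext j
    have := congrFun (congrFun (Matrix.mul_adjugate M) j) k
    rw [hdet, zero_smul] at this
    exact this
  · refine ⟨w' i / M.adjugate i k, ?_⟩
    ext j
    have := mul_adjugate_eq_of_mulVec_eq_zero hw' i j k
    simp only [Pi.smul_apply, smul_eq_mul]
    rw [div_mul_eq_mul_div, ← this, mul_div_cancel_right₀ _ hik]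

theorem exists_adjugate_ne_zero {M : Matrix (Fin n) (Fin n) ℂ} (hadj : M.adjugate ≠ 0)
    {w : Fin n → ℂ} (hw : M *ᵥ w = 0) {i : Fin n} (hi : w i ≠ 0) : ∃ k, M.adjugate i k ≠ 0 := by
  by_contra! h
  refine hadj ?_
  ext j k
  have := mul_adjugate_eq_of_mulVec_eq_zero hw i j k
  rw [h k, mul_zero, zero_eq_mul] at this
  exact this.resolve_left hi

/-- Kernel vectors of a convergent family of matrices converge projectively. -/
theorem tendsto_kernel {M : ℝ → Matrix (Fin n) (Fin n) ℂ} {M₀ : Matrix (Fin n) (Fin n) ℂ}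
    {l : Filter ℝ} (hM : Tendsto M l (𝓝 M₀)) (hadj : M₀.adjugate ≠ 0) {w : Fin n → ℂ}
    (hw : M₀ *ᵥ w = 0) {i : Fin n} (hi : w i ≠ 0) {x : ℝ → Fin n → ℂ}
    (hx : ∀ᶠ ε in l, x ε ≠ 0 ∧ M ε *ᵥ x ε = 0) :
    (∀ᶠ ε in l, x ε i ≠ 0) ∧ ∀ j, Tendsto (fun ε => x ε j / x ε i) l (𝓝 (w j / w i)) := by
  -- Column `k` of the adjugate spans the limit kernel and, by continuity, gives the ratios of the
  -- nearby kernel vectors.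
  obtain ⟨k, hk⟩ := exists_adjugate_ne_zero hadj hw hi
  have hA : ∀ j, Tendsto (fun ε => (M ε).adjugate j k) l (𝓝 (M₀.adjugate j k)) := by
    intro j
    have : Continuous fun M : Matrix (Fin n) (Fin n) ℂ => M.adjugate j k :=
      continuous_id.matrix_adjugate.matrix_elem j k
    exact (this.tendsto M₀).comp hM
  have hne : ∀ᶠ ε in l, (M ε).adjugate i k ≠ 0 := (hA i).eventually_ne hk
  have hxi : ∀ᶠ ε in l, x ε i ≠ 0 := by
    filter_upwards [hne, hx] with ε h1 h2 h0
    refine h2.1 (funext fun j => ?_)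
    have := mul_adjugate_eq_of_mulVec_eq_zero h2.2 i j k
    rw [h0, zero_mul, mul_eq_zero] at this
    exact this.resolve_right h1
  refine ⟨hxi, fun j => ?_⟩
  have hlim : w j / w i = M₀.adjugate j k / M₀.adjugate i k := by
    rw [div_eq_div_iff hi hk, mul_adjugate_eq_of_mulVec_eq_zero hw i j k, mul_comm]
  rw [hlim]
  refine ((hA j).div (hA i) hk).congr' ?_
  filter_upwards [hne, hx, hxi] with ε h1 h2 h3
  rw [Pi.div_apply, div_eq_div_iff h1 h3, mul_comm, ← mul_adjugate_eq_of_mulVec_eq_zero h2.2 i j k]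

/-! ### Simple roots of the determinant of a pencil -/

/-- The determinant, as a continuous multilinear function of the rows. -/
noncomputable def detCMM (n : ℕ) : ContinuousMultilinearMap ℂ (fun _ : Fin n => Fin n → ℂ) ℂ :=
  { (Matrix.detRowAlternating : (Fin n → ℂ) [⋀^Fin n]→ₗ[ℂ] ℂ).toMultilinearMap with
    cont := Continuous.matrix_det continuous_id }

/-- The derivative of `z ↦ det (z E - B)`, for a diagonal matrix `E`. -/
def pencilDeriv (e : Fin n → ℂ) (B : Fin n → Fin n → ℂ) (z : ℂ) : ℂ :=
  ∑ i, e i * (z • diagonal e - Matrix.of B).adjugate i i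

/-- By multilinearity one row is differentiated at a time; the derivative of row `i` is `e i` times
a basis vector, which leaves a diagonal cofactor. -/
theorem hasDerivAt_det_pencil (e : Fin n → ℂ) (B : Fin n → Fin n → ℂ) (z : ℂ) :
    HasDerivAt (fun z : ℂ => (z • diagonal e - Matrix.of B).det) (pencilDeriv e B z) z := by
  have h1 : HasDerivAt (fun z : ℂ => (fun i => (z • diagonal e - Matrix.of B) i : Fin n → Fin n → ℂ))
      (fun i => diagonal e i) z := by
    rw [hasDerivAt_pi]
    intro i
    rw [hasDerivAt_pi]
    intro j
    simpa using ((hasDerivAt_id z).mul_const (diagonal e i j)).sub_const (B i j)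
  have h2 := ((detCMM n).hasFDerivAt (x := fun i => (z • diagonal e - Matrix.of B) i)).comp_hasDerivAt
    z h1
  refine h2.congr_deriv ?_
  rw [ContinuousMultilinearMap.linearDeriv_apply, pencilDeriv]
  refine Finset.sum_congr rfl fun i _ => ?_
  have hrow : diagonal e i = e i • (Pi.single i 1 : Fin n → ℂ) := by
    ext j
    by_cases hij : i = j
    · subst hij
      simp
    · simp [hij]
  rw [hrow, Matrix.adjugate_apply, ← Matrix.det_updateRow_smul]
  rfl

theorem continuous_pencilDeriv :
    Continuous fun p : ((Fin n → ℂ) × (Fin n → Fin n → ℂ)) × ℂ => pencilDeriv p.1.1 p.1.2 p.2 := by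
  unfold pencilDeriv
  refine continuous_finsetSum _ fun i _ => Continuous.mul (by fun_prop) ?_
  refine Continuous.matrix_elem (Continuous.matrix_adjugate ?_) i i
  refine Continuous.sub (continuous_snd.smul ?_) ?_
  · exact Continuous.matrix_diagonal (by fun_prop)
  · exact continuous_fst.snd

theorem contDiff_det_pencil : ContDiff ℂ 1
    fun p : ((Fin n → ℂ) × (Fin n → Fin n → ℂ)) × ℂ =>
      (p.2 • diagonal p.1.1 - Matrix.of p.1.2).det := by
  have : ContDiff ℂ 1 fun p : ((Fin n → ℂ) × (Fin n → Fin n → ℂ)) × ℂ =>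
      (fun i => (p.2 • diagonal p.1.1 - Matrix.of p.1.2) i : Fin n → Fin n → ℂ) := by
    rw [contDiff_pi]
    intro i
    rw [contDiff_pi]
    intro j
    simp only [Matrix.sub_apply, Matrix.smul_apply, Matrix.diagonal_apply, Matrix.of_apply,
      smul_eq_mul]
    split_ifs <;> fun_prop
  exact (detCMM n).contDiff.comp this

/-- Continuous dependence of simple roots of `z ↦ det (z E - B)` on the matrices `E`, `B`. -/
theorem exists_root_pencil {e₀ : Fin n → ℂ} {B₀ : Fin n → Fin n → ℂ} {z₀ : ℂ}
    (h0 : (z₀ • diagonal e₀ - Matrix.of B₀).det = 0) (h1 : pencilDeriv e₀ B₀ z₀ ≠ 0) :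
    ∃ ψ : (Fin n → ℂ) × (Fin n → Fin n → ℂ) → ℂ, ψ (e₀, B₀) = z₀ ∧
      (∀ᶠ x in 𝓝 (e₀, B₀), ContinuousAt ψ x) ∧
      (∀ᶠ x in 𝓝 (e₀, B₀), (ψ x • diagonal x.1 - Matrix.of x.2).det = 0) ∧
      ∀ᶠ p in 𝓝 ((e₀, B₀), z₀), (p.2 • diagonal p.1.1 - Matrix.of p.1.2).det = 0 →
        p.2 = ψ p.1 := by
  set F : ((Fin n → ℂ) × (Fin n → Fin n → ℂ)) × ℂ → ℂ := fun p =>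
      (p.2 • diagonal p.1.1 - Matrix.of p.1.2).det with hF
  set u : ((Fin n → ℂ) × (Fin n → Fin n → ℂ)) × ℂ := ((e₀, B₀), z₀) with hu
  have hFu : F u = 0 := h0
  have hcd : ContDiffAt ℂ 1 F u := contDiff_det_pencil.contDiffAt
  have hderiv : (fderiv ℂ F u ∘L .inr ℂ _ ℂ) 1 = pencilDeriv e₀ B₀ z₀ := by
    have h2 : HasFDerivAt F (fderiv ℂ F u) u :=
      (hcd.differentiableAt one_ne_zero).hasFDerivAt
    have h3 : HasDerivAt (fun z : ℂ => ((e₀, B₀), z)) (0, 1) z₀ :=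
      (hasDerivAt_const z₀ (e₀, B₀)).prodMk (hasDerivAt_id z₀)
    have h4 := HasFDerivAt.comp_hasDerivAt (f := fun z : ℂ => ((e₀, B₀), z)) z₀ h2 h3
    exact h4.unique (hasDerivAt_det_pencil e₀ B₀ z₀)
  -- The partial derivative in `z` is multiplication by the nonzero scalar of `h1`.
  have hinv : (fderiv ℂ F u ∘L .inr ℂ _ ℂ).IsInvertible := by
    refine ⟨ContinuousLinearEquiv.unitsEquivAut ℂ (Units.mk0 _ h1), ?_⟩
    ext
    simp [← hderiv]
  refine ⟨hcd.implicitFunction one_ne_zero hinv, hcd.implicitFunction_apply_self one_ne_zero hinv,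
    ?_, ?_, ?_⟩
  · have := (hcd.contDiffAt_implicitFunction one_ne_zero hinv).eventually (by simp)
    exact this.mono fun x hx => hx.continuousAt
  · exact (hcd.eventually_apply_implicitFunction one_ne_zero hinv).mono fun x hx => hx.trans hFu
  · refine (hcd.eventually_apply_eq_iff_implicitFunction one_ne_zero hinv).mono fun p hp h => ?_
    exact (hp.1 (h.trans hFu.symm)).symm

/-! ### Diagonal scalings -/

/-- The left and right scalings need not be inverse to each other: the identity becomes a nontrivial
diagonal matrix, while roots and kernels still correspond when the factors are invertible. -/
theorem pencil_scaling (M : Matrix (Fin n) (Fin n) ℂ) (p q : Fin n → ℂ) (s z : ℂ) :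
    z • diagonal (fun i => p i * s * q i) - Matrix.of (fun i j => p i * M i j * q j) =
      diagonal p * ((z * s) • 1 - M) * diagonal q := by
  ext i j
  rw [Matrix.mul_diagonal, Matrix.diagonal_mul]
  by_cases hij : i = j
  · subst hij
    simp
    ring
  · simp [hij]

theorem det_pencil_scaling (M : Matrix (Fin n) (Fin n) ℂ) (p q : Fin n → ℂ) (s z : ℂ) :
    (z • diagonal (fun i => p i * s * q i) - Matrix.of (fun i j => p i * M i j * q j)).det =
      (∏ i, p i) * (∏ i, q i) * M.charpoly.eval (z * s) := by
  rw [pencil_scaling, Matrix.det_mul, Matrix.det_mul, Matrix.det_diagonal, Matrix.det_diagonal,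
    Matrix.eval_charpoly, Matrix.scalar_apply, Matrix.smul_one_eq_diagonal]
  ring

/-- This carries the simplicity of a root from the pencil back to the characteristic polynomial. -/
theorem pencilDeriv_scaling (M : Matrix (Fin n) (Fin n) ℂ) (p q : Fin n → ℂ) (s z : ℂ) :
    pencilDeriv (fun i => p i * s * q i) (fun i j => p i * M i j * q j) z =
      (∏ i, p i) * (∏ i, q i) * (M.charpoly.derivative.eval (z * s) * s) := by
  refine (hasDerivAt_det_pencil _ _ z).unique ?_
  simp only [det_pencil_scaling]
  refine HasDerivAt.const_mul _ ?_
  have h : HasDerivAt (fun z : ℂ => z * s) s z := by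
    simpa using! (hasDerivAt_id z).mul_const s
  exact (M.charpoly.hasDerivAt (z * s)).comp z h

theorem mulVec_pencil_scaling (M : Matrix (Fin n) (Fin n) ℂ) {p q : Fin n → ℂ}
    (hq : ∀ i, q i ≠ 0) (s z : ℂ) {x : Fin n → ℂ} (hx : M *ᵥ x = (z * s) • x) :
    (z • diagonal (fun i => p i * s * q i) - Matrix.of (fun i j => p i * M i j * q j)) *ᵥ
      (fun i => (q i)⁻¹ * x i) = 0 := by
  have hqx : diagonal q *ᵥ (fun i => (q i)⁻¹ * x i) = x := by
    ext i
    rw [Matrix.mulVec_diagonal, mul_inv_cancel_left₀ (hq i)]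
  rw [pencil_scaling, ← Matrix.mulVec_mulVec, ← Matrix.mulVec_mulVec, hqx, Matrix.sub_mulVec,
    Matrix.smul_mulVec, Matrix.one_mulVec, hx, sub_self, Matrix.mulVec_zero]

end Analysis

/-! ### Powers of `ε`, germs and scaled entries. -/

section Asymptotics

variable {n : ℕ}

theorem eventually_pos : ∀ᶠ ε : ℝ in 𝓝[>] 0, 0 < ε := eventually_mem_nhdsWithin

theorem tendsto_rpow_pos {x : ℝ} (hx : 0 < x) :
    Tendsto (fun ε : ℝ => ((ε ^ x : ℝ) : ℂ)) (𝓝[>] 0) (𝓝 0) := by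
  have h : Tendsto (fun ε : ℝ => ε ^ x) (𝓝[>] 0) (𝓝 0) := by
    have := (Real.continuousAt_rpow_const 0 x (Or.inr hx.le)).tendsto
    rw [Real.zero_rpow hx.ne'] at this
    exact this.mono_left nhdsWithin_le_nhds
  have h2 := (Complex.continuous_ofReal.tendsto 0).comp h
  rwa [Complex.ofReal_zero] at h2

theorem eventually_continuousAt_rpow (x : ℝ) :
    ∀ᶠ ε : ℝ in 𝓝[>] 0, ContinuousAt (fun ε : ℝ => ((ε ^ x : ℝ) : ℂ)) ε := by
  filter_upwards [eventually_pos] with ε hε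
  exact Complex.continuous_ofReal.continuousAt.comp
    (Real.continuousAt_rpow_const ε x (Or.inl hε.ne'))

theorem rpow_ne_zero {ε : ℝ} (hε : 0 < ε) (x : ℝ) : ((ε ^ x : ℝ) : ℂ) ≠ 0 :=
  Complex.ofReal_ne_zero.2 (Real.rpow_pos_of_pos hε x).ne'

theorem rpow_mul_rpow {ε : ℝ} (hε : 0 < ε) (x y : ℝ) :
    ((ε ^ x : ℝ) : ℂ) * ((ε ^ y : ℝ) : ℂ) = ((ε ^ (x + y) : ℝ) : ℂ) := by
  rw [← Complex.ofReal_mul, Real.rpow_add hε]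

theorem IsGerm.eventually_continuousAt {f : ℝ → ℂ} (h : IsGerm f) :
    ∀ᶠ ε in 𝓝[>] (0 : ℝ), ContinuousAt f ε := by
  obtain ⟨ε₀, hε₀, hc, -⟩ := h
  filter_upwards [Ioo_mem_nhdsGT hε₀] with ε hε
  exact hc.continuousAt (isOpen_Ioo.mem_nhds hε)

theorem isGerm_of_tendsto {φ : ℝ → ℂ} {z : ℂ} (hφ : Tendsto φ (𝓝[>] 0) (𝓝 z))
    (hc : ∀ᶠ ε in 𝓝[>] (0 : ℝ), ContinuousAt φ ε) (α : ℝ) :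
    IsGerm fun ε => φ ε * ((ε ^ α : ℝ) : ℂ) := by
  have hlim : Tendsto (fun ε => ((ε ^ (1 : ℝ) : ℝ) : ℂ) * φ ε) (𝓝[>] 0) (𝓝 (0 * z)) :=
    (tendsto_rpow_pos one_pos).mul hφ
  rw [zero_mul] at hlim
  have hlt : ∀ᶠ ε in 𝓝[>] (0 : ℝ), ‖((ε ^ (1 : ℝ) : ℝ) : ℂ) * φ ε‖ < 1 := by
    have := hlim.norm
    rw [norm_zero] at this
    exact this.eventually_lt_const one_pos
  have hall := (hlt.and (hc.and (eventually_continuousAt_rpow α))).and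
    (Ioo_mem_nhdsGT (one_pos : (0 : ℝ) < 1))
  obtain ⟨ε₀, hε₀, hsub⟩ := mem_nhdsGT_iff_exists_Ioo_subset.1 hall
  -- For small `ε < 1`, `φ` is bounded by `ε ^ (-1)` since `ε φ(ε) → 0`, and `ε ^ α` by `ε ^
  -- (-|α|)`.
  refine ⟨ε₀, hε₀, fun ε hε => ?_, |α| + 1, by positivity, fun ε hε => ?_⟩
  · exact ((hsub hε).1.2.1.mul (hsub hε).1.2.2).continuousWithinAt
  · obtain ⟨⟨h1, -⟩, hpos, hle⟩ := hsub hε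
    rw [norm_mul, Complex.norm_real, Real.norm_of_nonneg (Real.rpow_nonneg hpos.le _),
      Real.rpow_one] at h1
    rw [norm_mul, Complex.norm_real, Real.norm_of_nonneg (Real.rpow_nonneg hpos.le _)]
    have h2 : ‖φ ε‖ ≤ ε ^ (-1 : ℝ) := by
      rw [Real.rpow_neg_one, ← one_div, le_div_iff₀ hpos]
      linarith
    calc ‖φ ε‖ * ε ^ α ≤ ε ^ (-1 : ℝ) * ε ^ (-|α|) :=
          mul_le_mul h2 (Real.rpow_le_rpow_of_exponent_ge hpos hle.le (neg_abs_le α))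
            (Real.rpow_nonneg hpos.le _) (Real.rpow_nonneg hpos.le _)
      _ = ε ^ (-(|α| + 1)) := by
          rw [← Real.rpow_add hpos]
          congr 1
          ring

/-- The entries of the scaled matrices converge to the entries on the tight arcs. -/
theorem tendsto_scaled_entry {f : ℝ → ℂ} {b : ℂ} {B : Rmin} (hf : Approx f b B) {d v w : ℝ}
    (hB : ∀ x, B = ofReal x → v + d ≤ x + w) [Decidable (B = ofReal (v + d - w))] :
    Tendsto (fun ε : ℝ => ((ε ^ (-d - v) : ℝ) : ℂ) * f ε * ((ε ^ w : ℝ) : ℂ)) (𝓝[>] 0)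
      (𝓝 (if B = ofReal (v + d - w) then b else 0)) := by
  rcases eq_zero_or_ofReal B with rfl | ⟨x, rfl⟩
  · rw [if_neg (ofReal_ne_zero _).symm]
    refine tendsto_const_nhds.congr' ?_
    filter_upwards [hf.2 rfl] with ε hε
    simp [hε]
  · have h1 := hf.1 x rfl
    have hx := hB x rfl
    -- Split off the normalisation `ε ^ (-x)`; the remaining exponent is the slack of the potential
    -- inequality, zero exactly on tight arcs.
    have heq : (fun ε : ℝ => ((ε ^ (x - (v + d - w)) : ℝ) : ℂ) * (((ε ^ (-x) : ℝ) : ℂ) * f ε))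
        =ᶠ[𝓝[>] 0] fun ε : ℝ => ((ε ^ (-d - v) : ℝ) : ℂ) * f ε * ((ε ^ w : ℝ) : ℂ) := by
      filter_upwards [eventually_pos] with ε hε
      have he : ((ε ^ (x - (v + d - w)) : ℝ) : ℂ) * ((ε ^ (-x) : ℝ) : ℂ) =
          ((ε ^ (-d - v) : ℝ) : ℂ) * ((ε ^ w : ℝ) : ℂ) := by
        rw [rpow_mul_rpow hε, rpow_mul_rpow hε]
        congr 2
        ring
      rw [← mul_assoc, he, mul_right_comm]
    refine Tendsto.congr' heq ?_
    by_cases he : x = v + d - w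
    · rw [if_pos (by rw [he])]
      refine h1.congr fun ε => ?_
      rw [he, sub_self, Real.rpow_zero, Complex.ofReal_one, one_mul]
    · rw [if_neg (by rwa [ofReal_inj])]
      have hpos : 0 < x - (v + d - w) := by
        have : x - (v + d - w) ≠ 0 := sub_ne_zero.2 he
        have : 0 ≤ x - (v + d - w) := by linarith
        positivity
      simpa using (tendsto_rpow_pos hpos).mul h1

end Asymptotics

end MinPlus

open MinPlus

/-! ### Asymptotics of the eigenvalues and eigenvectors. -/

theorem mainTheorem8 {n : ℕ} (𝒜 : ℝ → Matrix (Fin n) (Fin n) ℂ)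
    (h𝒜 : ∀ i j, IsGerm fun ε => 𝒜 ε i j)
    (a : Matrix (Fin n) (Fin n) ℂ) (A : Matrix (Fin n) (Fin n) Rmin)
    (hA : IsIrred A)
    (haA : ∀ i j, Approx (fun ε => 𝒜 ε i j) (a i j) (A i j))
    (G : Digraph (Fin n))
    (hG : G = criticalGraph (hatLast A) ∨
      ∃ U : Fin n → Rmin, IsEigenvector (hatLast A) U ∧ G = satGraph (hatLast A) U)
    (ℓ : ℕ) (hℓ : ℓ < numLevels A)
    (hr : IsUnit (rMat a A G ℓ))
    (μ : ℂ) (hμ0 : μ ≠ 0) (hμ : (tMat a A G ℓ).charpoly.rootMultiplicity μ = 1)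
    (V : Fin n → Rmin) (hV : IsEigenvector (hat A ℓ) V) :
    (∃ w : Fin n → ℂ, w ≠ 0 ∧
      (μ • diagIndicator (nodesFrom A ℓ) - restrictTo (satGraph (hat A ℓ) V) a) *ᵥ w = 0 ∧
      ∀ w' : Fin n → ℂ,
        (μ • diagIndicator (nodesFrom A ℓ) - restrictTo (satGraph (hat A ℓ) V) a) *ᵥ w' = 0 →
        ∃ z : ℂ, w' = z • w) ∧
    ∃ L : ℝ → ℂ,
      IsGerm L ∧ IsEigenvalueFamily 𝒜 L ∧ Sim L μ (ofReal (critVal A ℓ)) ∧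
      (∀ᶠ ε in 𝓝[>] (0 : ℝ), (𝒜 ε).charpoly.rootMultiplicity (L ε) = 1) ∧
      (∀ L' : ℝ → ℂ, IsEigenvalueFamily 𝒜 L' → Sim L' μ (ofReal (critVal A ℓ)) →
        ∀ᶠ ε in 𝓝[>] (0 : ℝ), L' ε = L ε) ∧
      ∀ w : Fin n → ℂ,
        (μ • diagIndicator (nodesFrom A ℓ) - restrictTo (satGraph (hat A ℓ) V) a) *ᵥ w = 0 →
        ∀ i, w i ≠ 0 → ∀ W : ℝ → Fin n → ℂ, IsEigenvectorFamily 𝒜 L W →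
          (∀ᶠ ε in 𝓝[>] (0 : ℝ), W ε i ≠ 0) ∧
          ∀ j, Approx (fun ε => W ε j / W ε i) (w j / w i) (V j / V i) := by
  classical
  obtain ⟨c, hc, q, hdet⟩ := det_satGraph hA hG hℓ hV a hr
  obtain ⟨v, hVv, hv, hSat⟩ := hV.exists_potential hA hℓ
  set b := restrictTo (satGraph (hat A ℓ) V) a with hb
  set α := critVal A ℓ with hα
  set d := levelDiag A ℓ with hd
  set e₀ : Fin n → ℂ := fun i => if i ∈ nodesFrom A ℓ then 1 else 0 with he₀
  change ∀ z : ℂ, (z • diagonal e₀ - Matrix.of b).det = _ at hdet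
  change (∃ w : Fin n → ℂ, w ≠ 0 ∧ (μ • diagonal e₀ - Matrix.of b) *ᵥ w = 0 ∧
      ∀ w' : Fin n → ℂ, (μ • diagonal e₀ - Matrix.of b) *ᵥ w' = 0 → ∃ z : ℂ, w' = z • w) ∧ _
  -- the limit pencil has the simple root `μ`
  rw [rootMultiplicity_eq_one_iff (Matrix.charpoly_monic _).ne_zero] at hμ
  have hdet0 : (μ • diagonal e₀ - Matrix.of b).det = 0 := by rw [hdet, hμ.1, mul_zero, mul_zero]
  -- At a root of the characteristic polynomial only `c μ^q` times its derivative survives; `μ ≠ 0`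
  -- keeps the factor `μ^q` from vanishing.
  have hderiv : pencilDeriv e₀ b μ ≠ 0 := by
    have h1 := hasDerivAt_det_pencil e₀ b μ
    simp only [hdet] at h1
    have h2 := (((hasDerivAt_id μ).pow q).mul
      ((tMat a A G ℓ).charpoly.hasDerivAt μ)).const_mul c
    have h3 := h1.unique h2
    rw [h3, hμ.1]
    simp only [mul_zero, zero_add, Pi.pow_apply, id]
    exact mul_ne_zero hc (mul_ne_zero (pow_ne_zero q hμ0) hμ.2)
  have hadj : (μ • diagonal e₀ - Matrix.of b).adjugate ≠ 0 := by
    intro h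
    exact hderiv (by simp [pencilDeriv, h])
  refine ⟨kernel_of_adjugate_ne_zero hdet0 hadj, ?_⟩
  -- the scaled pencils
  set p : ℝ → Fin n → ℂ := fun ε i => ((ε ^ (-d i - v i) : ℝ) : ℂ) with hp
  set t : ℝ → Fin n → ℂ := fun ε i => ((ε ^ v i : ℝ) : ℂ) with ht
  set s : ℝ → ℂ := fun ε => ((ε ^ α : ℝ) : ℂ) with hs
  set E : ℝ → Fin n → ℂ := fun ε i => p ε i * s ε * t ε i with hE
  set B : ℝ → Fin n → Fin n → ℂ := fun ε i j => p ε i * 𝒜 ε i j * t ε j with hB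
  have hEt : Tendsto E (𝓝[>] 0) (𝓝 e₀) := by
    refine tendsto_pi_nhds.2 fun i => ?_
    have heq : (fun ε : ℝ => ((ε ^ (α - d i) : ℝ) : ℂ)) =ᶠ[𝓝[>] 0] fun ε => E ε i := by
      filter_upwards [eventually_pos] with ε hε
      simp only [hE, hp, hs, ht]
      rw [rpow_mul_rpow hε, rpow_mul_rpow hε]
      congr 2
      ring
    -- The exponent `α - d i` is zero on `N^ℓ` and positive elsewhere, by the strict growth of the
    -- critical values.
    refine Tendsto.congr' heq ?_
    by_cases hi : i ∈ nodesFrom A ℓ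
    · have : α - d i = 0 := by rw [hd, levelDiag_of_mem_nodesFrom hi, sub_self]
      simp [he₀, hi, this]
    · simpa [he₀, hi] using tendsto_rpow_pos (sub_pos.2 (levelDiag_lt hA hℓ hi))
  have hBt : Tendsto B (𝓝[>] 0) (𝓝 b) := by
    refine tendsto_pi_nhds.2 fun i => tendsto_pi_nhds.2 fun j => ?_
    have h1 := tendsto_scaled_entry (haA i j) (hv i j)
    have h2 : b i j = if A i j = ofReal (v i + d i - v j) then a i j else 0 := by
      have : (satGraph (hat A ℓ) V).Adj i j ↔ A i j = ofReal (v i + d i - v j) := by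
        rw [hSat]
        rfl
      simp only [hb, restrictTo, Matrix.of_apply, this]
    rw [h2]
    exact h1
  have hEB : Tendsto (fun ε => (E ε, B ε)) (𝓝[>] 0) (𝓝 (e₀, (b : Fin n → Fin n → ℂ))) :=
    hEt.prodMk_nhds hBt
  have hEBc : ∀ᶠ ε in 𝓝[>] (0 : ℝ), ContinuousAt (fun ε => (E ε, B ε)) ε := by
    have hpc : ∀ᶠ ε in 𝓝[>] (0 : ℝ), ∀ i, ContinuousAt (fun ε => p ε i) ε :=
      eventually_all.2 fun i => eventually_continuousAt_rpow _
    have htc : ∀ᶠ ε in 𝓝[>] (0 : ℝ), ∀ i, ContinuousAt (fun ε => t ε i) ε :=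
      eventually_all.2 fun i => eventually_continuousAt_rpow _
    have hAc : ∀ᶠ ε in 𝓝[>] (0 : ℝ), ∀ i j, ContinuousAt (fun ε => 𝒜 ε i j) ε :=
      eventually_all.2 fun i => eventually_all.2 fun j => (h𝒜 i j).eventually_continuousAt
    filter_upwards [hpc, htc, hAc, eventually_continuousAt_rpow α] with ε h1 h2 h3 h4
    refine ContinuousAt.prodMk (continuousAt_pi.2 fun i => ?_)
      (continuousAt_pi.2 fun i => continuousAt_pi.2 fun j => ?_)
    · exact ((h1 i).mul h4).mul (h2 i)
    · exact ((h1 i).mul (h3 i j)).mul (h2 j)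
  obtain ⟨ψ, hψ0, hψc, hψroot, hψuniq⟩ := exists_root_pencil hdet0 hderiv
  -- The rescaled eigenvalue: the root near `μ` of the scaled pencil.
  set φ : ℝ → ℂ := fun ε => ψ (E ε, B ε) with hφ
  have hφt : Tendsto φ (𝓝[>] 0) (𝓝 μ) := by
    have := hψc.self_of_nhds.tendsto.comp hEB
    rwa [hψ0] at this
  have hφc : ∀ᶠ ε in 𝓝[>] (0 : ℝ), ContinuousAt φ ε := by
    filter_upwards [hEBc, hEB.eventually hψc] with ε h1 h2
    exact ContinuousAt.comp (f := fun ε => (E ε, B ε)) h2 h1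
  have hκ : ∀ ε : ℝ, 0 < ε → (∏ i, p ε i) * (∏ i, t ε i) ≠ 0 := fun ε hε =>
    mul_ne_zero (Finset.prod_ne_zero_iff.2 fun i _ => rpow_ne_zero hε _)
      (Finset.prod_ne_zero_iff.2 fun i _ => rpow_ne_zero hε _)
  have hroot : ∀ᶠ ε in 𝓝[>] (0 : ℝ), (𝒜 ε).charpoly.eval (φ ε * s ε) = 0 := by
    filter_upwards [eventually_pos, hEB.eventually hψroot] with ε hε h
    have := (det_pencil_scaling (𝒜 ε) (p ε) (t ε) (s ε) (φ ε)).symm.trans h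
    exact (mul_eq_zero.1 this).resolve_left (hκ ε hε)
  refine ⟨fun ε => φ ε * s ε, isGerm_of_tendsto hφt hφc α, hroot, ⟨Or.inl hμ0, ?_, ?_⟩, ?_, ?_, ?_⟩
  · intro x hx
    rw [ofReal_inj] at hx
    subst hx
    refine hφt.congr' ?_
    filter_upwards [eventually_pos] with ε hε
    rw [mul_left_comm, hs, rpow_mul_rpow hε, neg_add_cancel, Real.rpow_zero, Complex.ofReal_one,
      mul_one]
  · exact fun h => absurd h (ofReal_ne_zero _)
  · have hD : ∀ᶠ ε in 𝓝[>] (0 : ℝ), pencilDeriv (E ε) (B ε) (φ ε) ≠ 0 :=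
      ((continuous_pencilDeriv.tendsto ((e₀, b), μ)).comp
        (hEB.prodMk_nhds hφt)).eventually_ne hderiv
    filter_upwards [hD, hroot] with ε h1 h2
    rw [rootMultiplicity_eq_one_iff (Matrix.charpoly_monic _).ne_zero]
    refine ⟨h2, fun h => h1 ?_⟩
    have := pencilDeriv_scaling (𝒜 ε) (p ε) (t ε) (s ε) (φ ε)
    rw [h, zero_mul, mul_zero] at this
    exact this
  · intro L' hL' hL's
    -- Any competing eigenvalue, once rescaled, tends to `μ` and so enters the neighbourhood where
    -- the root is unique.
    set z : ℝ → ℂ := fun ε => ((ε ^ (-α) : ℝ) : ℂ) * L' ε with hz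
    have hzt : Tendsto z (𝓝[>] 0) (𝓝 μ) := hL's.2.1 α rfl
    filter_upwards [eventually_pos, hL', (hEB.prodMk_nhds hzt).eventually hψuniq] with ε hε h1 h2
    have hzs : z ε * s ε = L' ε := by
      simp only [hz, hs]
      rw [mul_right_comm, rpow_mul_rpow hε, neg_add_cancel, Real.rpow_zero, Complex.ofReal_one,
        one_mul]
    have h3 := h2 (by
      have := det_pencil_scaling (𝒜 ε) (p ε) (t ε) (s ε) (z ε)
      rw [hzs, h1.eq_zero, mul_zero] at this
      exact this)
    rw [← hzs, h3]
  · intro w hw i hi W hW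
    have hMt : Tendsto (fun ε => φ ε • diagonal (E ε) - Matrix.of (B ε)) (𝓝[>] 0)
        (𝓝 (μ • diagonal e₀ - Matrix.of b)) := by
      refine Tendsto.sub (hφt.smul ?_) hBt
      exact ((continuous_id.matrix_diagonal).tendsto e₀).comp hEt
    -- Dividing coordinate `i` of an eigenvector by `ε ^ v i` gives a kernel vector of the scaled
    -- pencil; this is where the exponents `V j - V i` come from.
    have hker : ∀ᶠ ε in 𝓝[>] (0 : ℝ), (fun i => (t ε i)⁻¹ * W ε i) ≠ 0 ∧
        (φ ε • diagonal (E ε) - Matrix.of (B ε)) *ᵥ (fun i => (t ε i)⁻¹ * W ε i) = 0 := by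
      filter_upwards [eventually_pos, hW] with ε hε h
      refine ⟨fun h0 => h.1 (funext fun j => ?_), ?_⟩
      · exact (mul_eq_zero.1 (congrFun h0 j)).resolve_left (inv_ne_zero (rpow_ne_zero hε _))
      · exact mulVec_pencil_scaling (𝒜 ε) (fun j => rpow_ne_zero hε _) (s ε) (φ ε) h.2
    obtain ⟨h1, h2⟩ := tendsto_kernel hMt hadj hw hi hker
    refine ⟨h1.mono fun ε h h0 => h (by rw [h0, mul_zero]), fun j => ⟨?_, ?_⟩⟩
    · intro x hx
      have hx' : x = v j - v i := by
        rw [hVv, hVv] at hx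
        exact (ofReal_injective hx).symm
      refine (h2 j).congr' ?_
      filter_upwards [eventually_pos] with ε hε
      have h3 : ((ε ^ (-x) : ℝ) : ℂ) * t ε j = t ε i := by
        simp only [ht]
        rw [rpow_mul_rpow hε, hx']
        congr 2
        ring
      have h4 : t ε j ≠ 0 := rpow_ne_zero hε _
      rw [← h3]
      simp only [div_eq_mul_inv, mul_inv, inv_inv]
      calc _ = ((t ε j)⁻¹ * t ε j) * (((ε ^ (-x) : ℝ) : ℂ) * (W ε j * (W ε i)⁻¹)) := by ring
        _ = _ := by rw [inv_mul_cancel₀ h4, one_mul]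
    · intro h
      rw [hVv, hVv] at h
      exact absurd h (ofReal_ne_zero (v j - v i))
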